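/- Let $I$ be a finite set of players; player $i$ has a finite non-empty action set $A_i$, with $A=\prod_i A_i$, and a reward function $g_i:A\to\mathbb R$, extended to independent mixed action profiles $\alpha\in\prod_i\Delta A_i$ by expectation. Each player $i$ also has a finite set $Y_i$ of private signals, with $Y=\prod_i Y_i$, and $\pi:A\to\Delta Y$ gives the distribution of the signal profile after each action profile; $\pi_i(y_i\mid a)=\sum_{y_{-i}}\pi(y_i,y_{-i}\mid a)$ denotes its marginals. In each round $t=1,2,\dots$ the players choose actions simultaneously, a signal profile is drawn from $\pi(\cdot\mid a)$, and player $i$ observes only his own action and his own signal $y_i$. A behavior strategy of player $i$ maps his finite private histories (sequences of own actions and signals) to $\Delta A_i$. With discount factor $\delta_i\in[0,1)$, player $i$'s payoff is the expectation of $(1-\delta_i)\sum_{t\ge1}\delta_i^{t-1}g_i(a^{(t)})$. A strategy profile $\sigma$ is a Blackwell equilibrium if there is $\underline\delta\in[0,1)$ such that, for every vector $(\delta_i)_{i\in I}$ with $\underline\delta\le\delta_i<1$ for all $i$, $\sigma$ is a sequential equilibrium of the repeated game with discount factors $(\delta_i)_{i\in I}$; that is, there are beliefs (which may depend on the discount factors)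 at all private histories such that $\sigma$ is sequentially rational and the assessment is consistent, i.e. $\sigma$ and the beliefs are the pointwise limits of a sequence of completely mixed strategy profiles and of the Bayesian beliefs they induce. Let $\mathcal A^{\mathrm{MI}}$ be the set of mixed action profiles $\alpha$ such that $g_i(a_i,\alpha_{-i})=g_i(\alpha)$ for every player $i$ and every $a_i$ in the support of $\alpha_i$. Suppose that $\mathcal A^{\mathrm{MI}}=A$, i.e. $\mathcal A^{\mathrm{MI}}$ consists exactly of the pure action profiles (as in the prisoner's dilemma), that the monitoring structure is conditionally independent, i.e. $\pi(y\mid a)=\prod_i\pi_i(y_i\mid a)$ for all $a\in A$, $y\in Y$, and that it has full support, i.e. $\pi_i(y_i\mid a)>0$ for all $i\in I$, $y_i\in Y_i$, $a\in A$. Then the stage game has exactly one Nash equilibrium in mixed actions, this equilibrium is a pure action profile $a^*$, and the unique Blackwell equilibrium outcome is the repetition of $a^*$: a Blackwell equilibrium exists, and in every Blackwell equilibrium $a^*$ is played in every round with probability one. -/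

import Mathlib

open Filter Topology

namespace AntiFolk

/-! ### The stage game -/

section Stage

variable {I : Type*} [Fintype I] [DecidableEq I] {A : I → Type*}
  [∀ i, Fintype (A i)] [∀ i, DecidableEq (A i)]

/-- The pure action profile `a`, seen as a mixed action profile. -/
noncomputable def pureProfile (a : ∀ i, A i) : ∀ i, stdSimplex ℝ (A i) :=
  fun i => stdSimplex.vertex (a i)

/-- Expected value of a reward function `r` when the players mix independently
according to `α`. -/
noncomputable def expReward (r : (∀ i, A i) → ℝ) (α : ∀ i, stdSimplex ℝ (A i)) : ℝ :=
  ∑ a : ∀ i, A i, (∏ j, (α j).1 (a j)) * r a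

/-- The myopically indifferent mixed action profiles: against `α₋ᵢ`, every action in the
support of `αᵢ` gives player `i` the reward that `α` gives. -/
def myopicIndifference (g : I → (∀ i, A i) → ℝ) : Set (∀ i, stdSimplex ℝ (A i)) :=
  {α | ∀ i, ∀ a : A i, 0 < (α i).1 a →
    expReward (g i) (Function.update α i (stdSimplex.vertex a)) = expReward (g i) α}

/-- `α` is a (mixed) Nash equilibrium of the stage game. -/
def IsStageNash (g : I → (∀ i, A i) → ℝ) (α : ∀ i, stdSimplex ℝ (A i)) : Prop :=
  ∀ i, ∀ β : stdSimplex ℝ (A i), expReward (g i) (Function.update α i β) ≤ expReward (g i) α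

end Stage

/-! ### Private monitoring structures -/

section Monitoring

variable {I : Type*} [Fintype I] [DecidableEq I] {A Y : I → Type*}
  [∀ i, Fintype (Y i)] [∀ i, DecidableEq (Y i)]

/-- The marginal probability `πᵢ(yᵢ ∣ a)`. -/
noncomputable def marginal (π : (∀ i, A i) → stdSimplex ℝ (∀ i, Y i)) (i : I) (a : ∀ i, A i) (yi : Y i) : ℝ :=
  ∑ y : ∀ i, Y i, if y i = yi then (π a).1 y else 0

/-- Conditionally on the action profile, the private signals are independent. -/
def ConditionallyIndependent (π : (∀ i, A i) → stdSimplex ℝ (∀ i, Y i)) : Prop :=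
  ∀ (a : ∀ i, A i) (y : ∀ i, Y i), (π a).1 y = ∏ i, marginal π i a (y i)

/-- Every private signal has positive probability after every action profile. -/
def FullSupport (π : (∀ i, A i) → stdSimplex ℝ (∀ i, Y i)) : Prop :=
  ∀ (i : I) (yi : Y i) (a : ∀ i, A i), 0 < marginal π i a yi

end Monitoring

/-! ### The repeated game -/

section Repeated

variable {I : Type*} (A Y : I → Type*)

/-- What happens in one round: an action profile and a signal profile. -/
abbrev Round : Type _ := (∀ i, A i) × (∀ i, Y i)

/-- A behavior strategy profile: each player maps his private histories, in chronological
order, to mixed actions. -/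
abbrev StrategyProfile [∀ i, Fintype (A i)] : Type _ :=
  ∀ i, List (A i × Y i) → stdSimplex ℝ (A i)

variable {A Y}

/-- Player `i`'s private part of a history. -/
def priv (i : I) (h : List (Round A Y)) : List (A i × Y i) :=
  h.map fun x => (x.1 i, x.2 i)

variable [∀ i, Fintype (A i)]

/-- The continuation strategy profile after the history `h`. -/
def continuation (σ : StrategyProfile A Y) (h : List (Round A Y)) : StrategyProfile A Y :=
  fun i h' => σ i (priv i h ++ h')

variable [Fintype I] [DecidableEq I] [∀ i, DecidableEq (A i)]
  [∀ i, Fintype (Y i)] [∀ i, DecidableEq (Y i)]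

/-- The probability that play starts with the history `h` when the players use `σ`. -/
noncomputable def histProb (π : (∀ i, A i) → stdSimplex ℝ (∀ i, Y i)) :
    StrategyProfile A Y → List (Round A Y) → ℝ
  | _, [] => 1
  | σ, x :: h =>
      (∏ i, (σ i []).1 (x.1 i)) * (π x.1).1 x.2 * histProb π (continuation σ [x]) h

/-- The expectation under `σ` of the reward `r` that is obtained in the round that
follows `t` rounds of play. -/
noncomputable def roundReward (π : (∀ i, A i) → stdSimplex ℝ (∀ i, Y i)) (r : (∀ i, A i) → ℝ)
    (σ : StrategyProfile A Y) (t : ℕ) : ℝ :=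
  ∑ h : Fin t → Round A Y,
    histProb π σ (List.ofFn h) * expReward r (fun i => σ i (priv i (List.ofFn h)))

/-- The expected average discounted payoff from the reward function `r`, with discount
factor `d`, when the players use `σ`. -/
noncomputable def payoff (π : (∀ i, A i) → stdSimplex ℝ (∀ i, Y i)) (r : (∀ i, A i) → ℝ)
    (σ : StrategyProfile A Y) (d : ℝ) : ℝ :=
  (1 - d) * ∑' t : ℕ, d ^ t * roundReward π r σ t

/-- The probability that player `i`'s private history after `hi.length` rounds is `hi`. -/
noncomputable def privProb (π : (∀ i, A i) → stdSimplex ℝ (∀ i, Y i)) (σ : StrategyProfile A Y)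
    (i : I) (hi : List (A i × Y i)) : ℝ :=
  ∑ h : Fin hi.length → Round A Y,
    if priv i (List.ofFn h) = hi then histProb π σ (List.ofFn h) else 0

/-- The conditional probability, under `σ`, of the history `h` given that player `i`'s private
history is `hi`. -/
noncomputable def posterior (π : (∀ i, A i) → stdSimplex ℝ (∀ i, Y i)) (σ : StrategyProfile A Y)
    (i : I) (hi : List (A i × Y i)) (h : Fin hi.length → Round A Y) : ℝ :=
  if priv i (List.ofFn h) = hi then histProb π σ (List.ofFn h) / privProb π σ i hi else 0

/-- The private history `hi` is an information set of the game: the monitoring structure does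
not exclude it. -/
def Possible (π : (∀ i, A i) → stdSimplex ℝ (∀ i, Y i)) (i : I) (hi : List (A i × Y i)) : Prop :=
  ∃ σ : StrategyProfile A Y, 0 < privProb π σ i hi

variable (A Y) in
/-- A system of beliefs: at each private history of each player, a probability distribution
over the histories of the same length. -/
abbrev Beliefs : Type _ :=
  ∀ (i : I) (hi : List (A i × Y i)), stdSimplex ℝ (Fin hi.length → Round A Y)

/-- Consistency of an assessment: `σ` is the pointwise limit of completely mixed strategy
profiles, and at every information set the beliefs are the limit of the Bayesian beliefs
derived from these profiles. -/
def Consistent (π : (∀ i, A i) → stdSimplex ℝ (∀ i, Y i)) (σ : StrategyProfile A Y)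
    (μ : Beliefs A Y) : Prop :=
  ∃ τ : ℕ → StrategyProfile A Y,
    (∀ k i hi a, 0 < (τ k i hi).1 a) ∧
    (∀ i hi a, Tendsto (fun k => (τ k i hi).1 a) atTop (𝓝 ((σ i hi).1 a))) ∧
    ∀ i hi, Possible π i hi → ∀ h,
      Tendsto (fun k => posterior π (τ k) i hi h) atTop (𝓝 ((μ i hi).1 h))

/-- Player `i`'s expected continuation payoff at his private history `hi`, given the
beliefs `μ`, when the players use `σ`. -/
noncomputable def interimPayoff (π : (∀ i, A i) → stdSimplex ℝ (∀ i, Y i)) (r : (∀ i, A i) → ℝ)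
    (μ : Beliefs A Y) (σ : StrategyProfile A Y) (d : ℝ) (i : I) (hi : List (A i × Y i)) : ℝ :=
  ∑ h : Fin hi.length → Round A Y,
    (μ i hi).1 h * payoff π r (continuation σ (List.ofFn h)) d

/-- At every information set of every player, no strategy of that player gives him a higher
expected continuation payoff than his own one. -/
def SequentiallyRational (g : I → (∀ i, A i) → ℝ) (π : (∀ i, A i) → stdSimplex ℝ (∀ i, Y i))
    (δ : I → ℝ) (σ : StrategyProfile A Y) (μ : Beliefs A Y) : Prop :=
  ∀ i hi, Possible π i hi → ∀ τ : List (A i × Y i) → stdSimplex ℝ (A i),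
    interimPayoff π (g i) μ (Function.update σ i τ) (δ i) i hi ≤
      interimPayoff π (g i) μ σ (δ i) i hi

/-- `σ` is a sequential equilibrium of the repeated game with discount factors `δ`. -/
def IsSequentialEquilibrium (g : I → (∀ i, A i) → ℝ)
    (π : (∀ i, A i) → stdSimplex ℝ (∀ i, Y i)) (δ : I → ℝ) (σ : StrategyProfile A Y) : Prop :=
  ∃ μ : Beliefs A Y, Consistent π σ μ ∧ SequentiallyRational g π δ σ μ

/-- `σ` is a Blackwell (sequential) equilibrium: for some `d < 1` it is a sequential equilibrium
for all discount factor vectors that are bounded below by `d`. -/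
def IsBlackwellEquilibrium (g : I → (∀ i, A i) → ℝ)
    (π : (∀ i, A i) → stdSimplex ℝ (∀ i, Y i)) (σ : StrategyProfile A Y) : Prop :=
  ∃ d : ℝ, 0 ≤ d ∧ d < 1 ∧
    ∀ δ : I → ℝ, (∀ i, d ≤ δ i ∧ δ i < 1) → IsSequentialEquilibrium g π δ σ

/-- The probability, under `σ`, that the action profiles of the first `t` rounds are
`a 0, …, a (t - 1)`. -/
noncomputable def outcomeProb (π : (∀ i, A i) → stdSimplex ℝ (∀ i, Y i)) (σ : StrategyProfile A Y)
    (t : ℕ) (a : Fin t → ∀ i, A i) : ℝ :=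
  ∑ y : Fin t → ∀ i, Y i, histProb π σ (List.ofFn fun s => (a s, y s))

/-- The outcome of `σ` is (almost surely) the infinite sequence of action profiles `a`: for
every `t`, with probability one the first `t` action profiles are those of `a`. -/
def HasOutcome (π : (∀ i, A i) → stdSimplex ℝ (∀ i, Y i)) (σ : StrategyProfile A Y)
    (a : ℕ → ∀ i, A i) : Prop :=
  ∀ t : ℕ, outcomeProb π σ t (fun s => a s) = 1

end Repeated

end AntiFolk

set_option linter.unusedSectionVars false

/-! In a Blackwell equilibrium, every action that a player uses in the first round is optimal for
all discount factors in an interval `[d, 1)`. The difference between the discounted payoff of such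
an action and the equilibrium payoff is a power series in the discount factor that vanishes on this
interval, so its constant term is zero: the first-round profile is myopically indifferent, hence
pure.

To repeat this in later rounds, regard the signals received so far as private types. After a pure
profile, conditional independence keeps them independent across players, and full support gives each
of them positive weight. The power series argument (`IsTypeNash.meanAction_mem`) then applies to the
type-averaged profile. If the average is pure, all types choose the same action
(`IsTypeNash.exists_first_action`), and the next signals are added to the types
(`IsTypeNash.continuation`). So play follows a fixed path whatever the signals. A deviation then
goes unanswered, every round must be a stage Nash equilibrium (`IsTypeNash.isStageNash`), and the
path is constant once that equilibrium is unique.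

Uniqueness (`eq_of_mutually_stable`) rests on the fact that reversing one player's preferences
leaves the set of myopically indifferent profiles unchanged: an equilibrium of the reversed game,
restricted to two actions per player, is therefore pure as well. Nash equilibria exist as limits of
logit equilibria, which are fixed points of a smooth map; Brouwer's theorem for such maps is proved
by the Milnor–Rogers volume argument.

Conversely, repeating the stage equilibrium is optimal against every history, so any consistent
beliefs support it; they are obtained by compactness. -/

namespace AntiFolk

/-! ### Brouwer's fixed point theorem for bounded continuously differentiable maps -/

section Brouwer

open MeasureTheory Polynomial Metric

variable {E : Type*} [NormedAddCommGroup E] [InnerProductSpace ℝ E] [FiniteDimensional ℝ E]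

lemma exists_polynomial_det_one_add_smul (L : E →L[ℝ] E) :
    ∃ q : ℝ[X], q.natDegree ≤ Module.finrank ℝ E ∧ ∀ t : ℝ, q.eval t = (1 + t • L).det := by
  classical
  let b := Module.finBasis ℝ E
  let M := LinearMap.toMatrix b b (L : E →ₗ[ℝ] E)
  refine ⟨Matrix.det ((X : ℝ[X]) • M.map C + (1 : Matrix _ _ ℝ).map C), ?_, fun t => ?_⟩
  · simpa using natDegree_det_X_add_C_le M 1
  · rw [← coe_evalRingHom, RingHom.map_det, ContinuousLinearMap.det, ← LinearMap.det_toMatrix b]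
    congr 1
    ext i j
    by_cases h : i = j <;> simp [M, h, LinearMap.toMatrix_apply] <;> ring

/-- The determinant is a polynomial in `t` of degree at most the dimension, so its values at
finitely many integers determine it. In this form it stays polynomial in `t` after integration over
a family of maps `L`. -/
lemma det_one_add_smul_eq_sum_lagrange (L : E →L[ℝ] E) (t : ℝ) :
    (1 + t • L).det = ∑ k ∈ Finset.range (Module.finrank ℝ E + 1), (1 + (k : ℝ) • L).det *
      (Lagrange.basis (Finset.range (Module.finrank ℝ E + 1)) (fun k : ℕ => (k : ℝ)) k).eval t := by
  obtain ⟨q, hq, hqe⟩ := exists_polynomial_det_one_add_smul L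
  have h := Lagrange.eq_interpolate_of_eval_eq (s := Finset.range (Module.finrank ℝ E + 1))
    (v := fun k : ℕ => (k : ℝ)) (r := fun k => (1 + (k : ℝ) • L).det) (f := q)
    (fun i _ j _ h => by simpa using h)
    (by
      rw [Finset.card_range]
      exact lt_of_le_of_lt degree_le_natDegree (by exact_mod_cast Nat.lt_succ_of_le hq))
    (fun i _ => hqe i)
  rw [← hqe t, h, Lagrange.interpolate_apply, eval_finsetSum]
  simp only [eval_mul, eval_C]

lemma exists_polynomial_integral_det [MeasurableSpace E] [BorelSpace E] (μ : Measure E)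
    [IsFiniteMeasureOnCompacts μ] {K U : Set E} (hK : IsCompact K) (hU : U ⊆ K)
    {L : E → E →L[ℝ] E} (hL : ContinuousOn L K) :
    ∃ P : ℝ[X], ∀ t : ℝ, P.eval t = ∫ x in U, (1 + t • L x).det ∂μ := by
  have hint : ∀ t : ℝ, IntegrableOn (fun x => (1 + t • L x).det) U μ := by
    intro t
    have h1 : ContinuousOn (fun x => 1 + t • L x) K := by fun_prop
    have h2 : ContinuousOn (fun x => (1 + t • L x).det) K :=
      ContinuousLinearMap.continuous_det.comp_continuousOn h1
    exact (h2.integrableOn_compact hK).mono_set hU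
  refine ⟨∑ k ∈ Finset.range (Module.finrank ℝ E + 1), C (∫ x in U, (1 + (k : ℝ) • L x).det ∂μ) *
    Lagrange.basis (Finset.range (Module.finrank ℝ E + 1)) (fun k : ℕ => (k : ℝ)) k, fun t => ?_⟩
  rw [integral_congr_ae (Eventually.of_forall fun x => det_one_add_smul_eq_sum_lagrange (L x) t),
    integral_finsetSum _ fun k _ => (hint _).mul_const _, eval_finsetSum]
  refine Finset.sum_congr rfl fun k _ => ?_
  rw [integral_mul_const, eval_mul, eval_C]

omit [FiniteDimensional ℝ E] in
/-- A Lipschitz map on the closed ball that vanishes on the sphere stays Lipschitz when it is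
extended by zero. -/
lemma lipschitzWith_indicator_closedBall {g : E → E} {c : NNReal}
    (hg : LipschitzOnWith c g (closedBall 0 1)) (h0 : ∀ x, ‖x‖ = 1 → g x = 0) :
    LipschitzWith c ((closedBall (0 : E) 1).indicator g) := by
  have key : ∀ x ∈ closedBall (0 : E) 1, ∀ y ∉ closedBall (0 : E) 1,
      dist (g x) 0 ≤ c * dist x y := by
    intro x hx y hy
    simp only [mem_closedBall, dist_zero_right, not_le] at hx hy
    -- The segment from `x` to `y` crosses the sphere, where `g` vanishes.
    obtain ⟨s, hs, hsn⟩ : (1 : ℝ) ∈ (fun s : ℝ => ‖AffineMap.lineMap x y s‖) '' Set.Icc 0 1 := by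
      apply intermediate_value_Icc zero_le_one
      · exact (AffineMap.lineMap_continuous.norm).continuousOn
      · simpa using ⟨hx, hy.le⟩
    have hz : ‖AffineMap.lineMap x y s‖ = 1 := hsn
    calc dist (g x) 0 = dist (g x) (g (AffineMap.lineMap x y s)) := by rw [h0 _ hz]
      _ ≤ c * dist x (AffineMap.lineMap x y s) :=
          hg.dist_le_mul _ (by simpa using hx) _ (by simp [hz])
      _ ≤ c * dist x y := by
          gcongr
          rw [dist_left_lineMap, Real.norm_of_nonneg hs.1]
          exact mul_le_of_le_one_left dist_nonneg hs.2
  refine LipschitzWith.of_dist_le_mul fun x y => ?_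
  by_cases hx : x ∈ closedBall (0 : E) 1 <;> by_cases hy : y ∈ closedBall (0 : E) 1
  · simpa [Set.indicator_of_mem, hx, hy] using hg.dist_le_mul x hx y hy
  · simpa only [Set.indicator_of_mem hx, Set.indicator_of_notMem hy] using key x hx y hy
  · simp only [Set.indicator_of_notMem hx, Set.indicator_of_mem hy]
    rw [dist_comm, dist_comm x]
    exact key y hy x hx
  · simp only [Set.indicator_of_notMem hx, Set.indicator_of_notMem hy, dist_self]
    positivity

/-- Solving `x + h x = y` means finding a fixed point of the contraction `x ↦ y - h x`. -/
lemma bijective_add_of_lipschitzWith {h : E → E} {c : NNReal} (hc : c < 1)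
    (hh : LipschitzWith c h) : Function.Bijective fun x => x + h x := by
  constructor
  · intro x y hxy
    have h1 : x - y = h y - h x := by
      have : x + h x = y + h y := hxy
      rw [sub_eq_sub_iff_add_eq_add, this]; abel
    have h2 : dist x y ≤ c * dist x y := by
      conv_lhs => rw [dist_eq_norm, h1, ← dist_eq_norm, dist_comm]
      exact hh.dist_le_mul x y
    have h3 : (c : ℝ) < 1 := by exact_mod_cast hc
    exact dist_le_zero.1 (by nlinarith [dist_nonneg (x := x) (y := y)])
  · intro y
    have : ContractingWith c fun x => y - h x :=
      ⟨hc, by simpa using (LipschitzWith.const y).sub hh⟩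
    exact ⟨_, by
      have := this.fixedPoint_isFixedPt
      exact eq_sub_iff_add_eq.1 this.symm⟩

/-- Along `t ∈ [0, 1]` the map `1 + t • L` stays injective, so its determinant cannot change sign
from its value `1` at `t = 0`. -/
lemma det_one_add_pos {L : E →L[ℝ] E} (hL : ‖L‖ < 1) : 0 < (1 + L).det := by
  have hne : ∀ t ∈ Set.Icc (0 : ℝ) 1, (1 + t • L).det ≠ 0 := by
    intro t ht
    have hlt : ‖t • L‖ < 1 := by
      rw [norm_smul, Real.norm_of_nonneg ht.1]
      exact lt_of_le_of_lt (mul_le_of_le_one_left (norm_nonneg _) ht.2) hL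
    have hinj : LinearMap.ker ((1 + t • L : E →L[ℝ] E) : E →ₗ[ℝ] E) = ⊥ := by
      rw [LinearMap.ker_eq_bot']
      intro x hx
      have hx' : x + (t • L) x = 0 := hx
      by_contra hx0
      have h1 : ‖x‖ = ‖(t • L) x‖ := by
        rw [← norm_neg ((t • L) x), ← eq_neg_of_add_eq_zero_left hx']
      have h2 := (t • L).le_opNorm x
      have := norm_pos_iff.2 hx0
      nlinarith
    exact ((LinearMap.isUnit_iff_isUnit_det _).1
      ((LinearMap.isUnit_iff_ker_eq_bot _).2 hinj)).ne_zero
  by_contra hneg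
  have hcont : ContinuousOn (fun t : ℝ => (1 + t • L).det) (Set.Icc 0 1) :=
    (ContinuousLinearMap.continuous_det.comp (by fun_prop)).continuousOn
  obtain ⟨t, ht, ht0⟩ : (0 : ℝ) ∈ (fun t : ℝ => (1 + t • L).det) '' Set.Icc 0 1 := by
    apply intermediate_value_Icc' zero_le_one hcont
    refine ⟨by simpa using hneg, ?_⟩
    simp [ContinuousLinearMap.det]
  exact hne t ht ht0

/-- There is no continuously differentiable retraction of the closed ball onto the sphere. -/
theorem no_contDiffOn_retraction {W : Set E} (hW : IsOpen W) (hsub : closedBall 0 1 ⊆ W)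
    {r : E → E} (hr : ContDiffOn ℝ 1 r W) (hnorm : ∀ x ∈ closedBall (0 : E) 1, ‖r x‖ = 1)
    (hfix : ∀ x, ‖x‖ = 1 → r x = x) : False := by
  borelize E
  let μ : Measure E := volume
  let K : Set E := closedBall 0 1
  let U : Set E := ball 0 1
  have hUK : U ⊆ K := ball_subset_closedBall
  have hK : IsCompact K := isCompact_closedBall 0 1
  let g : E → E := fun x => r x - x
  have hg : ContDiffOn ℝ 1 g W := hr.sub contDiffOn_id
  have hgd : ∀ x ∈ W, HasFDerivAt g (fderiv ℝ g x) x := fun x hx =>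
    ((hg.differentiableOn one_ne_zero).differentiableAt (hW.mem_nhds hx)).hasFDerivAt
  have hcont : ContinuousOn (fderiv ℝ g) K :=
    (hg.continuousOn_fderiv_of_isOpen hW le_rfl).mono hsub
  obtain ⟨c₀, hc₀⟩ := hK.exists_bound_of_continuousOn hcont
  let c : NNReal := Real.toNNReal (max c₀ 1)
  have hcpos : (1 : ℝ) ≤ c := by simp [c]
  have hc : ∀ x ∈ K, ‖fderiv ℝ g x‖ ≤ c := fun x hx =>
    (hc₀ x hx).trans (by simp [c])
  have hlip : LipschitzOnWith c g K :=
    (convex_closedBall 0 1).lipschitzOnWith_of_nnnorm_fderiv_le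
      (fun x hx => (hgd x (hsub hx)).differentiableAt) (fun x hx => by exact_mod_cast hc x hx)
  have hg0 : ∀ x, ‖x‖ = 1 → g x = 0 := fun x hx => by simp [g, hfix x hx]
  have hG := lipschitzWith_indicator_closedBall hlip hg0
  obtain ⟨P, hP⟩ := exists_polynomial_integral_det μ hK hUK hcont
  -- For `t < 1 / c` the perturbation `t • g` is a contraction, so `x ↦ x + t • g x` maps the open
  -- ball bijectively onto itself and `P` gives the volume of the image. A polynomial that is
  -- constant on an interval is constant.
  have hvol : ∀ t ∈ Set.Ioo (0 : ℝ) (1 / c), P.eval t = μ.real U := by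
    intro t ht
    have htc : t * c < 1 := by
      have := ht.2
      rwa [lt_div_iff₀ (by linarith)] at this
    have ht1 : t < 1 := by nlinarith [ht.1]
    have hbij : Function.Bijective fun x => x + t • K.indicator g x := by
      refine bijective_add_of_lipschitzWith (c := Real.toNNReal t * c) ?_ ?_
      · rw [← NNReal.coe_lt_coe]
        simpa [ht.1.le] using htc
      · refine LipschitzWith.of_dist_le_mul fun x y => ?_
        have := hG.dist_le_mul x y
        rw [dist_smul₀, Real.norm_of_nonneg ht.1.le]
        simp only [NNReal.coe_mul, Real.coe_toNNReal _ ht.1.le, mul_assoc]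
        exact mul_le_mul_of_nonneg_left this ht.1.le
    have hout : ∀ x ∉ U, x + t • K.indicator g x = x := by
      intro x hx
      by_cases hxK : x ∈ K
      · have : ‖x‖ = 1 := le_antisymm (by simpa [K] using hxK) (by simpa [U] using hx)
        simp [Set.indicator_of_mem hxK, hg0 x this]
      · simp [Set.indicator_of_notMem hxK]
    have himg : (fun x => x + t • g x) '' U = U := by
      ext y
      constructor
      · rintro ⟨x, hx, rfl⟩
        have hx1 : ‖x‖ < 1 := by simpa [U] using hx
        have : x + t • g x = (1 - t) • x + t • r x := by
          simp only [g, smul_sub, sub_smul, one_smul]; abel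
        simp only [U, mem_ball, dist_zero_right, this]
        calc ‖(1 - t) • x + t • r x‖ ≤ ‖(1 - t) • x‖ + ‖t • r x‖ := norm_add_le _ _
          _ = (1 - t) * ‖x‖ + t := by
            rw [norm_smul, norm_smul, hnorm x (hUK hx), Real.norm_of_nonneg ht.1.le,
              Real.norm_of_nonneg (by linarith), mul_one]
          _ < 1 := by nlinarith
      · intro hy
        obtain ⟨x, hx⟩ := hbij.2 y
        have hxU : x ∈ U := by
          by_contra h
          have := hout x h
          rw [← hx] at hy
          simp only [this] at hy
          exact h hy
        exact ⟨x, hxU, by simpa [Set.indicator_of_mem (hUK hxU)] using hx⟩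
    have hinj : Set.InjOn (fun x => x + t • g x) U := by
      intro x hx y hy hxy
      apply hbij.1
      simpa [Set.indicator_of_mem (hUK hx), Set.indicator_of_mem (hUK hy)] using hxy
    have hder : ∀ x ∈ U, HasFDerivWithinAt (fun x => x + t • g x)
        (1 + t • fderiv ℝ g x) U x := fun x hx =>
      ((hasFDerivAt_id x).add ((hgd x (hsub (hUK hx))).const_smul t)).hasFDerivWithinAt
    have hint := integral_image_eq_integral_abs_det_fderiv_smul μ measurableSet_ball hder hinj
      (fun _ => (1 : ℝ))
    rw [himg] at hint
    rw [hP t]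
    simp only [integral_const, smul_eq_mul, mul_one, measureReal_restrict_apply_univ] at hint
    rw [hint]
    refine setIntegral_congr_fun measurableSet_ball fun x hx => ?_
    refine (abs_of_pos (det_one_add_pos ?_)).symm
    rw [norm_smul, Real.norm_of_nonneg ht.1.le]
    exact lt_of_le_of_lt (mul_le_mul_of_nonneg_left (hc x (hUK hx)) ht.1.le) htc
  have hPC : P = C (μ.real U) := by
    refine Polynomial.eq_of_infinite_eval_eq _ _ ((Set.Ioo_infinite (a := (0 : ℝ))
      (b := 1 / c) (by positivity)).mono fun t ht => ?_)
    simp [hvol t ht]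
  -- At `t = 1` the map is `r`, whose values are unit vectors: the range of its derivative is
  -- orthogonal to `r x ≠ 0`, so the determinant vanishes.
  have h1 : P.eval 1 = 0 := by
    rw [hP 1]
    refine (setIntegral_congr_fun measurableSet_ball fun x hx => ?_).trans (integral_zero _ _)
    by_contra hdet
    have hrx : HasFDerivAt r (1 + (1 : ℝ) • fderiv ℝ g x) x := by
      have := (hasFDerivAt_id x).add (hgd x (hsub (hUK hx)))
      rw [one_smul]
      refine this.congr_of_eventuallyEq (Eventually.of_forall fun y => ?_)
      simp [g]
    set D := (1 + (1 : ℝ) • fderiv ℝ g x) with hD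
    have hsq : HasFDerivAt (fun y => inner ℝ (r y) (r y)) (0 : E →L[ℝ] ℝ) x := by
      refine (hasFDerivAt_const (1 : ℝ) x).congr_of_eventuallyEq ?_
      filter_upwards [isOpen_ball.mem_nhds hx] with y hy
      rw [real_inner_self_eq_norm_sq, hnorm y (hUK hy), one_pow]
    have horth : ∀ v, inner ℝ (r x) (D v) = 0 := by
      intro v
      have := congrArg (fun T : E →L[ℝ] ℝ => T v) ((hrx.inner ℝ hrx).unique hsq)
      simp [real_inner_comm] at this
      simpa [real_inner_comm] using this
    have hsurj : LinearMap.range (D : E →ₗ[ℝ] E) = ⊤ :=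
      (LinearMap.isUnit_iff_range_eq_top _).1
        ((LinearMap.isUnit_iff_isUnit_det _).2 (isUnit_iff_ne_zero.2 hdet))
    obtain ⟨v, hv⟩ : r x ∈ LinearMap.range (D : E →ₗ[ℝ] E) := by rw [hsurj]; trivial
    have hv' : D v = r x := hv
    have := horth v
    rw [hv', real_inner_self_eq_norm_sq, hnorm x (hUK hx)] at this
    norm_num at this
  rw [hPC, eval_C] at h1
  have : 0 < μ.real U := by
    rw [measureReal_def]
    exact ENNReal.toReal_pos (measure_ball_pos μ 0 one_pos).ne' measure_ball_lt_top.ne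
  exact this.ne' h1

/-- Brouwer's fixed point theorem for a continuously differentiable map into the open unit ball. -/
lemma exists_fixedPoint_of_norm_lt_one {f : E → E} (hf : ContDiff ℝ 1 f)
    (hlt : ∀ x, ‖f x‖ < 1) : ∃ x, f x = x := by
  by_contra! hne
  let u : E → E := fun x => x - f x
  let b : E → ℝ := fun x => inner ℝ x (u x)
  -- A quarter of the discriminant of `‖x + s • u x‖ ^ 2 = 1`, a quadratic equation in `s`. The
  -- retraction moves `x` away from `f x` up to the sphere, `s` being the larger root; on the sphere
  -- `b x > 0` makes this root zero.
  let D : E → ℝ := fun x => b x ^ 2 + ‖u x‖ ^ 2 * (1 - ‖x‖ ^ 2)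
  have hu : ∀ x, 0 < ‖u x‖ ^ 2 := fun x =>
    pow_pos (norm_pos_iff.2 (sub_ne_zero.2 (hne x).symm)) 2
  have huC : ContDiff ℝ 1 u := contDiff_id.sub hf
  have hbC : ContDiff ℝ 1 b := contDiff_id.inner ℝ huC
  have hDC : ContDiff ℝ 1 D :=
    (hbC.pow 2).add ((huC.norm_sq ℝ).mul (contDiff_const.sub (contDiff_id.norm_sq ℝ)))
  have hb : ∀ x, ‖x‖ = 1 → 0 < b x := by
    intro x hx
    have h1 : b x = 1 - inner ℝ x (f x) := by
      simp only [b, u, inner_sub_right, real_inner_self_eq_norm_sq, hx, one_pow]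
    have h2 := real_inner_le_norm x (f x)
    rw [hx, one_mul] at h2
    linarith [hlt x]
  refine no_contDiffOn_retraction (W := {x | 0 < D x})
    (isOpen_lt continuous_const hDC.continuous) (fun x hx => ?_)
    (r := fun x => x + ((-b x + √(D x)) / ‖u x‖ ^ 2) • u x) ?_ (fun x hx => ?_) (fun x hx => ?_)
  · have hx1 : ‖x‖ ≤ 1 := by simpa using hx
    show 0 < D x
    rcases hx1.lt_or_eq with h | h
    · have : 0 < 1 - ‖x‖ ^ 2 := by nlinarith [norm_nonneg x]
      have := mul_pos (hu x) this
      have := sq_nonneg (b x)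
      simp only [D]; linarith
    · simp only [D, h]
      have := pow_pos (hb x h) 2
      linarith
  · refine contDiffOn_id.add (ContDiffOn.smul ?_ huC.contDiffOn)
    exact (hbC.neg.contDiffOn.add (hDC.contDiffOn.sqrt fun x hx => ne_of_gt hx)).div
      (huC.norm_sq ℝ).contDiffOn fun x _ => (hu x).ne'
  · have hx1 : ‖x‖ ≤ 1 := by simpa using hx
    have hD0 : 0 ≤ D x := by
      have : 0 ≤ 1 - ‖x‖ ^ 2 := by nlinarith [norm_nonneg x]
      have := mul_nonneg (hu x).le this
      have := sq_nonneg (b x)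
      simp only [D]; linarith
    have hs := Real.sq_sqrt hD0
    have hsq : ‖x + ((-b x + √(D x)) / ‖u x‖ ^ 2) • u x‖ ^ 2 = 1 := by
      rw [norm_add_sq_real, inner_smul_right, norm_smul, mul_pow, Real.norm_eq_abs, sq_abs]
      change ‖x‖ ^ 2 + 2 * ((-b x + √(D x)) / ‖u x‖ ^ 2 * b x) + _ = 1
      have hne' := (hu x).ne'
      have hDx : D x = b x ^ 2 + ‖u x‖ ^ 2 * (1 - ‖x‖ ^ 2) := rfl
      generalize √(D x) = s at *
      generalize ‖u x‖ ^ 2 = w at *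
      field_simp
      linear_combination hs + hDx
    exact (sq_eq_sq₀ (norm_nonneg _) zero_le_one).1 (by simpa using hsq)
  · have : D x = b x ^ 2 := by simp [D, hx]
    simp [this, Real.sqrt_sq (hb x hx).le]

/-- Brouwer's fixed point theorem for a bounded continuously differentiable map. -/
theorem exists_fixedPoint_of_contDiff {f : E → E} (hf : ContDiff ℝ 1 f) {R : ℝ}
    (hR : ∀ x, ‖f x‖ < R) : ∃ x, f x = x := by
  have hpos : 0 < R := (norm_nonneg _).trans_lt (hR 0)
  obtain ⟨x, hx⟩ := exists_fixedPoint_of_norm_lt_one (f := fun x => R⁻¹ • f (R • x))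
    (contDiff_const.smul (hf.comp (contDiff_const.smul contDiff_id))) (fun x => by
      rw [norm_smul, Real.norm_of_nonneg (inv_nonneg.2 hpos.le), inv_mul_lt_iff₀ hpos, mul_one]
      exact hR _)
  exact ⟨R • x, by
    conv_rhs => rw [← hx]
    rw [smul_inv_smul₀ hpos.ne']⟩

end Brouwer

/-! ### The stage game: multilinearity of expected rewards, Nash equilibria, myopic indifference -/

section StageGame

variable {I : Type*} [Fintype I] [DecidableEq I] {A : I → Type*}
  [∀ i, Fintype (A i)] [∀ i, DecidableEq (A i)]

lemma vertex_val_apply {X : Type*} [Fintype X] [DecidableEq X] (a b : X) :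
    (stdSimplex.vertex (S := ℝ) a).1 b = if b = a then 1 else 0 := by
  rw [show (stdSimplex.vertex (S := ℝ) a).1 = Pi.single a 1 from rfl, Pi.single_apply]

lemma eq_vertex_of_forall_ne {X : Type*} [Fintype X] [DecidableEq X] {β : stdSimplex ℝ X} {a : X}
    (h : ∀ b, b ≠ a → β.1 b = 0) : β = stdSimplex.vertex a := by
  refine Subtype.ext (funext fun b => ?_)
  rw [vertex_val_apply]
  split_ifs with hb
  · have := β.2.2
    rw [Finset.sum_eq_single a (fun c _ hc => h c hc) (by simp)] at this
    rw [hb, this]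
  · exact h b hb

lemma expReward_update_vertex (r : (∀ i, A i) → ℝ) (α : ∀ i, stdSimplex ℝ (A i)) (i : I) (a : A i) :
    expReward r (Function.update α i (stdSimplex.vertex a)) =
      ∑ c : ∀ i, A i, if c i = a then (∏ j ∈ Finset.univ.erase i, (α j).1 (c j)) * r c else 0 := by
  refine Finset.sum_congr rfl fun c _ => ?_
  rw [← Finset.mul_prod_erase _ _ (Finset.mem_univ i), Function.update_self, vertex_val_apply]
  have : ∏ j ∈ Finset.univ.erase i, (Function.update α i (stdSimplex.vertex a) j).1 (c j) =
      ∏ j ∈ Finset.univ.erase i, (α j).1 (c j) :=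
    Finset.prod_congr rfl fun j hj => by rw [Function.update_of_ne (Finset.ne_of_mem_erase hj)]
  rw [this]
  split_ifs <;> simp

lemma expReward_update (r : (∀ i, A i) → ℝ) (α : ∀ i, stdSimplex ℝ (A i)) (i : I)
    (β : stdSimplex ℝ (A i)) :
    expReward r (Function.update α i β) =
      ∑ b, β.1 b * expReward r (Function.update α i (stdSimplex.vertex b)) := by
  simp_rw [expReward_update_vertex, Finset.mul_sum]
  rw [Finset.sum_comm]
  refine Finset.sum_congr rfl fun c _ => ?_
  rw [Finset.sum_eq_single (c i) (fun b _ hb => by simp [hb.symm]) (by simp), if_pos rfl,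
    ← Finset.mul_prod_erase _ _ (Finset.mem_univ i), Function.update_self, ← mul_assoc]
  congr 2
  exact Finset.prod_congr rfl fun j hj => by
    rw [Function.update_of_ne (Finset.ne_of_mem_erase hj)]

lemma expReward_eq_sum (r : (∀ i, A i) → ℝ) (α : ∀ i, stdSimplex ℝ (A i)) (i : I) :
    expReward r α = ∑ b, (α i).1 b * expReward r (Function.update α i (stdSimplex.vertex b)) := by
  rw [← expReward_update, Function.update_eq_self]

lemma expReward_pureProfile (r : (∀ i, A i) → ℝ) (a : ∀ i, A i) :
    expReward r (pureProfile a) = r a := by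
  rw [expReward, Finset.sum_eq_single a]
  · simp [pureProfile, vertex_val_apply]
  · intro c _ hc
    obtain ⟨i, hi⟩ := Function.ne_iff.1 hc
    rw [Finset.prod_eq_zero (Finset.mem_univ i), zero_mul]
    simp [pureProfile, vertex_val_apply, hi]
  · simp

lemma update_pureProfile (a : ∀ i, A i) (i : I) (b : A i) :
    Function.update (pureProfile a) i (stdSimplex.vertex b) =
      pureProfile (Function.update a i b) := by
  funext j
  by_cases h : j = i
  · subst h; simp [pureProfile]
  · simp [pureProfile, h]

lemma pureProfile_injective : Function.Injective (pureProfile (A := A)) := by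
  intro a b h
  funext i
  exact stdSimplex.vertex_injective (congrFun h i)

lemma continuous_expReward (r : (∀ i, A i) → ℝ) : Continuous (expReward r) := by
  refine continuous_finsetSum _ fun c _ => Continuous.mul ?_ continuous_const
  exact continuous_finsetProd _ fun j _ =>
    (continuous_apply (c j)).comp (continuous_subtype_val.comp (continuous_apply j))

/-- The logit response of every player against `α`, with precision `l`, over the actions in `B`. -/
noncomputable def logit (g : I → (∀ i, A i) → ℝ) (B : ∀ i, Finset (A i)) (l : ℝ)
    (α : ∀ i, stdSimplex ℝ (A i)) (i : I) (a : A i) : ℝ :=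
  if a ∈ B i then Real.exp (l * expReward (g i) (Function.update α i (stdSimplex.vertex a))) /
    ∑ b ∈ B i, Real.exp (l * expReward (g i) (Function.update α i (stdSimplex.vertex b))) else 0

lemma exists_logit_fixedPoint (g : I → (∀ i, A i) → ℝ) (B : ∀ i, Finset (A i))
    (hB : ∀ i, (B i).Nonempty) (l : ℝ) :
    ∃ α : ∀ i, stdSimplex ℝ (A i), ∀ i a, (α i).1 a = logit g B l α i a := by
  -- The expected reward is extended as a polynomial to all real vectors. Logit weights are
  -- probabilities even there, so a fixed point in the whole space is automatically a profile of
  -- mixed actions.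
  let U : EuclideanSpace ℝ (Σ i, A i) → ∀ i, A i → ℝ := fun x i a =>
    ∑ c : ∀ i, A i, if c i = a then (∏ j ∈ Finset.univ.erase i, x ⟨j, c j⟩) * g i c else 0
  let N : EuclideanSpace ℝ (Σ i, A i) → ∀ i, A i → ℝ := fun x i a =>
    if a ∈ B i then Real.exp (l * U x i a) / ∑ b ∈ B i, Real.exp (l * U x i b) else 0
  have hcoord : ∀ k : Σ i, A i, ContDiff ℝ 1 fun x : EuclideanSpace ℝ (Σ i, A i) => x k :=
    fun k => contDiff_piLp_apply 2
  have hU : ∀ i a, ContDiff ℝ 1 fun x => U x i a := by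
    intro i a
    refine ContDiff.sum fun c _ => ?_
    split_ifs
    · exact (contDiff_prod fun j _ => hcoord ⟨j, c j⟩).mul contDiff_const
    · exact contDiff_const
  have hpos : ∀ x i, 0 < ∑ b ∈ B i, Real.exp (l * U x i b) := fun x i =>
    Finset.sum_pos (fun b _ => Real.exp_pos _) (hB i)
  have hN : ∀ i a, ContDiff ℝ 1 fun x => N x i a := by
    intro i a
    by_cases h : a ∈ B i
    · simp only [N, h, if_true]
      exact ((contDiff_const.mul (hU i a)).exp).div
        (ContDiff.sum fun b _ => (contDiff_const.mul (hU i b)).exp) fun x => (hpos x i).ne'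
    · simp only [N, h, if_false]
      exact contDiff_const
  have hN0 : ∀ x i a, 0 ≤ N x i a := by
    intro x i a
    simp only [N]
    split_ifs
    · exact div_nonneg (Real.exp_pos _).le (hpos x i).le
    · exact le_rfl
  have hNsum : ∀ x i, ∑ a, N x i a = 1 := by
    intro x i
    simp only [N]
    rw [← Finset.sum_filter, Finset.filter_mem_eq_inter, Finset.univ_inter, ← Finset.sum_div,
      div_self (hpos x i).ne']
  let F : EuclideanSpace ℝ (Σ i, A i) → EuclideanSpace ℝ (Σ i, A i) := fun x =>
    WithLp.toLp 2 fun k => N x k.1 k.2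
  have hF : ContDiff ℝ 1 F := contDiff_piLp' 2 fun k => hN k.1 k.2
  have hbound : ∀ x, ‖F x‖ < √(Fintype.card (Σ i, A i)) + 1 := by
    intro x
    refine lt_of_le_of_lt ?_ (lt_add_one _)
    rw [EuclideanSpace.norm_eq]
    refine Real.sqrt_le_sqrt ?_
    rw [← nsmul_one, ← Finset.card_univ, ← Finset.sum_const]
    refine Finset.sum_le_sum fun k _ => ?_
    have h1 : N x k.1 k.2 ≤ 1 :=
      hNsum x k.1 ▸ Finset.single_le_sum (fun a _ => hN0 x k.1 a) (Finset.mem_univ k.2)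
    have : ‖F x k‖ = N x k.1 k.2 := Real.norm_of_nonneg (hN0 x k.1 k.2)
    rw [this]
    exact pow_le_one₀ (hN0 x k.1 k.2) h1
  obtain ⟨x, hx⟩ := exists_fixedPoint_of_contDiff hF hbound
  have hxN : ∀ i a, x ⟨i, a⟩ = N x i a := fun i a => by
    conv_lhs => rw [← hx]
  refine ⟨fun i => ⟨fun a => x ⟨i, a⟩, fun a => ?_, ?_⟩, fun i a => ?_⟩
  · exact (hN0 x i a).trans_eq (hxN i a).symm
  · simp_rw [hxN]; exact hNsum x i
  · simp only [logit, expReward_update_vertex]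
    exact hxN i a

/-- Only the term of `b` is kept in the denominator. An action that is worse than `b` thus has
exponentially small weight as `l` grows. -/
lemma logit_le (g : I → (∀ i, A i) → ℝ) (B : ∀ i, Finset (A i)) (l : ℝ)
    (α : ∀ i, stdSimplex ℝ (A i)) (i : I) (a : A i) {b : A i} (hb : b ∈ B i) :
    logit g B l α i a ≤
      Real.exp (l * (expReward (g i) (Function.update α i (stdSimplex.vertex a)) -
        expReward (g i) (Function.update α i (stdSimplex.vertex b)))) := by
  unfold logit
  split_ifs
  · rw [mul_sub, Real.exp_sub]
    exact div_le_div_of_nonneg_left (Real.exp_pos _).le (Real.exp_pos _)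
      (Finset.single_le_sum (f := fun b =>
        Real.exp (l * expReward (g i) (Function.update α i (stdSimplex.vertex b))))
        (fun c _ => (Real.exp_pos _).le) hb)
  · exact (Real.exp_pos _).le

/-- Nash's theorem for the stage game in which player `i` may only use the actions in `B i`. -/
theorem exists_nash_on (g : I → (∀ i, A i) → ℝ) (B : ∀ i, Finset (A i))
    (hB : ∀ i, (B i).Nonempty) :
    ∃ α : ∀ i, stdSimplex ℝ (A i), ∀ i a, 0 < (α i).1 a → a ∈ B i ∧ ∀ b ∈ B i,
      expReward (g i) (Function.update α i (stdSimplex.vertex b)) ≤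
        expReward (g i) (Function.update α i (stdSimplex.vertex a)) := by
  choose x hx using fun n : ℕ => exists_logit_fixedPoint g B hB n
  obtain ⟨α, -, φ, hφ, hlim⟩ := isCompact_univ.tendsto_subseq fun n => Set.mem_univ (x n)
  have hcoord : ∀ i a, Tendsto (fun n => (x (φ n) i).1 a) atTop (𝓝 ((α i).1 a)) := by
    intro i a
    have : Continuous fun β : ∀ i, stdSimplex ℝ (A i) => (β i).1 a :=
      (continuous_apply a).comp (continuous_subtype_val.comp (continuous_apply i))
    exact (this.tendsto α).comp hlim
  have hval : ∀ i (a : A i), Tendsto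
      (fun n => expReward (g i) (Function.update (x (φ n)) i (stdSimplex.vertex a))) atTop
      (𝓝 (expReward (g i) (Function.update α i (stdSimplex.vertex a)))) := by
    intro i a
    have : Continuous fun β : ∀ i, stdSimplex ℝ (A i) =>
        expReward (g i) (Function.update β i (stdSimplex.vertex a)) :=
      (continuous_expReward (g i)).comp (continuous_id.update i continuous_const)
    exact (this.tendsto α).comp hlim
  refine ⟨α, fun i a ha => ⟨?_, fun b hb => ?_⟩⟩
  · by_contra hmem
    refine ha.ne (tendsto_nhds_unique (tendsto_const_nhds.congr fun n => ?_) (hcoord i a))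
    rw [hx]; simp [logit, hmem]
  · by_contra! hlt
    -- If `a` were worse than `b` in the limit, the gap would eventually stay below some `c < 0` and
    -- the weight of `a` below `exp (φ n * c)`, which tends to zero.
    have hdiff := (hval i a).sub (hval i b)
    obtain ⟨c, hc⟩ := exists_between (sub_neg.2 hlt)
    have hzero : Tendsto (fun n : ℕ => Real.exp ((φ n : ℝ) * c)) atTop (𝓝 0) :=
      Real.tendsto_exp_atBot.comp
        ((tendsto_natCast_atTop_atTop.comp hφ.tendsto_atTop).atTop_mul_const_of_neg hc.2)
    refine ha.not_ge (le_of_tendsto_of_tendsto (hcoord i a) hzero ?_)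
    filter_upwards [hdiff.eventually_lt_const hc.1] with n hn
    rw [hx]
    refine (logit_le g B _ _ i a hb).trans (Real.exp_le_exp.2 ?_)
    exact mul_le_mul_of_nonneg_left hn.le (Nat.cast_nonneg _)

lemma mem_myopicIndifference_of_forall_le {g : I → (∀ i, A i) → ℝ} {α : ∀ i, stdSimplex ℝ (A i)}
    (h : ∀ i a, 0 < (α i).1 a → ∀ b, 0 < (α i).1 b →
      expReward (g i) (Function.update α i (stdSimplex.vertex b)) ≤
        expReward (g i) (Function.update α i (stdSimplex.vertex a))) :
    α ∈ myopicIndifference g := by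
  intro i a ha
  have : ∀ b, (α i).1 b * expReward (g i) (Function.update α i (stdSimplex.vertex b)) =
      (α i).1 b * expReward (g i) (Function.update α i (stdSimplex.vertex a)) := by
    intro b
    rcases ((α i).2.1 b).eq_or_lt with h0 | h0
    · rw [← h0, zero_mul, zero_mul]
    · rw [le_antisymm (h i a ha b h0) (h i b h0 a ha)]
  rw [expReward_eq_sum (g i) α i, Finset.sum_congr rfl fun b _ => this b, ← Finset.sum_mul,
    (α i).2.2, one_mul]

lemma isStageNash_pureProfile_iff {g : I → (∀ i, A i) → ℝ} {a : ∀ i, A i} :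
    IsStageNash g (pureProfile a) ↔ ∀ i b, g i (Function.update a i b) ≤ g i a := by
  constructor
  · intro h i b
    have := h i (stdSimplex.vertex b)
    rwa [update_pureProfile, expReward_pureProfile, expReward_pureProfile] at this
  · intro h i β
    rw [expReward_update, expReward_pureProfile]
    calc _ ≤ ∑ b, β.1 b * g i a := Finset.sum_le_sum fun b _ => by
            rw [update_pureProfile, expReward_pureProfile]
            exact mul_le_mul_of_nonneg_left (h i b) (β.2.1 b)
      _ = g i a := by rw [← Finset.sum_mul, β.2.2, one_mul]

lemma IsStageNash.mem_myopicIndifference {g : I → (∀ i, A i) → ℝ}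
    {α : ∀ i, stdSimplex ℝ (A i)} (h : IsStageNash g α) : α ∈ myopicIndifference g := by
  intro i a ha
  refine le_antisymm (h i _) ?_
  by_contra! hlt
  have : expReward (g i) α < ∑ b, (α i).1 b * expReward (g i) α := by
    conv_lhs => rw [expReward_eq_sum (g i) α i]
    exact Finset.sum_lt_sum (fun b _ => mul_le_mul_of_nonneg_left (h i _) ((α i).2.1 b))
      ⟨a, Finset.mem_univ a, mul_lt_mul_of_pos_left hlt ha⟩
  rw [← Finset.sum_mul, (α i).2.2, one_mul] at this
  exact lt_irrefl _ this

/-- If all myopically indifferent profiles are pure, no player is ever indifferent between two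
actions against a pure profile. -/
lemma eq_of_reward_update_eq {g : I → (∀ i, A i) → ℝ}
    (hMI : myopicIndifference g ⊆ Set.range pureProfile) {a : ∀ i, A i} {i : I} {b : A i}
    (h : g i (Function.update a i b) = g i a) : b = a i := by
  by_contra hne
  -- Half weight on each of the two actions gives a myopically indifferent profile that is not pure.
  let β : stdSimplex ℝ (A i) := ⟨fun c => (1 / 2) * (stdSimplex.vertex (S := ℝ) (a i)).1 c +
    (1 / 2) * (stdSimplex.vertex (S := ℝ) b).1 c, fun c => by
      have := (stdSimplex.vertex (S := ℝ) (a i)).2.1 c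
      have := (stdSimplex.vertex (S := ℝ) b).2.1 c
      positivity, by
      rw [Finset.sum_add_distrib, ← Finset.mul_sum, ← Finset.mul_sum,
        (stdSimplex.vertex (S := ℝ) (a i)).2.2, (stdSimplex.vertex (S := ℝ) b).2.2]
      norm_num⟩
  have hβ : ∀ c, 0 < β.1 c → c = a i ∨ c = b := by
    intro c hc
    by_contra! hcon
    simp [β, hcon.1, hcon.2] at hc
  have hmem : Function.update (pureProfile a) i β ∈ myopicIndifference g := by
    refine mem_myopicIndifference_of_forall_le fun j c hc d hd => ?_
    by_cases hj : j = i
    · subst hj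
      rw [Function.update_self] at hc hd
      rw [Function.update_idem, Function.update_idem, update_pureProfile, update_pureProfile,
        expReward_pureProfile, expReward_pureProfile]
      rcases hβ c hc with rfl | rfl <;> rcases hβ d hd with rfl | rfl <;> simp [h]
    · rw [Function.update_of_ne hj] at hc hd
      have hcd : ∀ c, 0 < (pureProfile a j).1 c → c = a j := by
        intro c hc
        by_contra hcon
        simp [pureProfile, vertex_val_apply, hcon] at hc
      rw [hcd c hc, hcd d hd]
  obtain ⟨c, hc⟩ := hMI hmem
  have h1 := congrArg (fun γ => (γ i).1 (a i)) hc
  have h2 : β.1 (a i) = 1 / 2 := by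
    simp [β, Ne.symm hne]
  simp only [pureProfile, Function.update_self, vertex_val_apply, h2] at h1
  split_ifs at h1 <;> norm_num at h1

lemma expReward_neg (r : (∀ i, A i) → ℝ) (α : ∀ i, stdSimplex ℝ (A i)) :
    expReward (fun a => -r a) α = -expReward r α := by
  simp [expReward]

/-- Reversing the preferences of one player does not affect myopic indifference. -/
lemma myopicIndifference_update_neg (g : I → (∀ i, A i) → ℝ) (k : I) :
    myopicIndifference (Function.update g k fun a => -g k a) = myopicIndifference g := by
  ext α
  refine forall_congr' fun i => forall₂_congr fun a _ => ?_
  by_cases hi : i = k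
  · subst hi
    simp [expReward_neg]
  · simp [hi]

/-- If all myopically indifferent profiles are pure, two pure profiles coincide as soon as no
player wants to move unilaterally from one of them to his action in the other one. -/
theorem eq_of_mutually_stable {g : I → (∀ i, A i) → ℝ}
    (hMI : myopicIndifference g ⊆ Set.range pureProfile) (n : ℕ) :
    ∀ a b : ∀ i, A i, (Finset.univ.filter fun i => a i ≠ b i).card ≤ n →
      (∀ i, g i (Function.update a i (b i)) ≤ g i a) →
      (∀ i, g i (Function.update b i (a i)) ≤ g i b) → a = b := by
  induction n with
  | zero =>
    intro a b hn _ _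
    rw [Nat.le_zero, Finset.card_eq_zero, Finset.filter_eq_empty_iff] at hn
    exact funext fun i => not_not.1 (hn (Finset.mem_univ i))
  | succ n ih =>
    intro a b hn ha hb
    by_contra hne
    obtain ⟨k, hk⟩ := Function.ne_iff.1 hne
    -- An equilibrium of the game restricted to the actions in `a` and `b`, with the preferences of
    -- `k` reversed. It is myopically indifferent for `g` too, hence a pure profile `c`.
    obtain ⟨α, hα⟩ := exists_nash_on (Function.update g k fun a => -g k a)
      (fun i => {a i, b i}) fun i => Finset.insert_nonempty _ _
    have hαMI : α ∈ myopicIndifference g := by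
      rw [← myopicIndifference_update_neg g k]
      exact mem_myopicIndifference_of_forall_le fun i c hc d hd => (hα i c hc).2 d (hα i d hd).1
    obtain ⟨c, rfl⟩ := hMI hαMI
    have hc : ∀ i, c i ∈ ({a i, b i} : Finset (A i)) ∧ ∀ d ∈ ({a i, b i} : Finset (A i)),
        Function.update g k (fun a => -g k a) i (Function.update c i d) ≤
          Function.update g k (fun a => -g k a) i c := by
      intro i
      have := hα i (c i) (by simp [pureProfile, vertex_val_apply])
      refine ⟨this.1, fun d hd => ?_⟩
      have h2 := this.2 d hd
      rwa [update_pureProfile, expReward_pureProfile, update_pureProfile, expReward_pureProfile,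
        Function.update_eq_self] at h2
    have hck : ∀ d ∈ ({a k, b k} : Finset (A k)), g k c ≤ g k (Function.update c k d) := by
      intro d hd
      simpa using (hc k).2 d hd
    have hcne : ∀ i, i ≠ k → ∀ d ∈ ({a i, b i} : Finset (A i)),
        g i (Function.update c i d) ≤ g i c := by
      intro i hi d hd
      simpa [hi] using (hc i).2 d hd
    -- the flipped game has its equilibrium at neither of the two profiles
    have main : ∀ x y : ∀ i, A i, (∀ i, c i = x i ∨ c i = y i) →
        (∀ i, ∀ d, d = x i ∨ d = y i → d ∈ ({a i, b i} : Finset (A i))) →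
        (Finset.univ.filter fun i => x i ≠ y i).card ≤ n + 1 → x k ≠ y k →
        (∀ i, g i (Function.update x i (y i)) ≤ g i x) → c k = x k → False := by
      intro x y hxy hmem hcard hxk hx hcx
      -- Where `c` differs from `x` it agrees with `y`, and it does not differ at `k`; so `x` and
      -- `c` are mutually stable with fewer disagreements.
      have hxc : x = c := by
        refine ih x c ?_ (fun i => ?_) fun i => ?_
        · refine Nat.le_of_lt_succ (lt_of_lt_of_le (Finset.card_lt_card ?_) hcard)
          refine Finset.ssubset_iff_of_subset (fun i hi => ?_) |>.2 ⟨k, by simp [hxk], by simp [hcx]⟩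
          simp only [Finset.mem_filter, Finset.mem_univ, true_and] at hi ⊢
          intro h
          rcases hxy i with h' | h'
          · exact hi h'.symm
          · exact hi (h.trans h'.symm)
        · rcases hxy i with h' | h'
          · rw [h', Function.update_eq_self]
          · rw [h']; exact hx i
        · by_cases hi : i = k
          · subst hi
            rw [← hcx, Function.update_eq_self]
          · exact hcne i hi _ (hmem i _ (Or.inl rfl))
      subst hxc
      -- Stability of `x` says that `k` does not gain by moving to `y k`; the reversed preferences
      -- at `c = x` say that he does not lose. So he is indifferent.
      exact hxk (eq_of_reward_update_eq hMI
        (le_antisymm (hx k) (hck _ (hmem k _ (Or.inr rfl))))).symm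
    have hmem : ∀ i, c i = a i ∨ c i = b i := fun i => by simpa using (hc i).1
    rcases hmem k with h | h
    · exact main a b hmem (fun i d hd => by simpa using hd) hn hk ha h
    · refine main b a (fun i => (hmem i).symm) (fun i d hd => by simpa using hd.symm) ?_ hk.symm hb h
      simpa only [ne_comm] using hn

/-- If all myopically indifferent profiles are pure, the stage game has a unique Nash equilibrium,
which is pure. -/
theorem exists_unique_stageNash [∀ i, Nonempty (A i)] {g : I → (∀ i, A i) → ℝ}
    (hMI : myopicIndifference g ⊆ Set.range pureProfile) :
    ∃ e : ∀ i, A i, ∀ α, IsStageNash g α ↔ α = pureProfile e := by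
  obtain ⟨α, hα⟩ := exists_nash_on g (fun _ => Finset.univ) fun _ => Finset.univ_nonempty
  obtain ⟨e, rfl⟩ := hMI
    (mem_myopicIndifference_of_forall_le fun i c hc d _ => (hα i c hc).2 d (Finset.mem_univ d))
  have he : ∀ i b, g i (Function.update e i b) ≤ g i e := by
    intro i b
    have := (hα i (e i) (by simp [pureProfile, vertex_val_apply])).2 b (Finset.mem_univ b)
    rwa [update_pureProfile, expReward_pureProfile, update_pureProfile, expReward_pureProfile,
      Function.update_eq_self] at this
  refine ⟨e, fun α => ⟨fun h => ?_, fun h => h ▸ isStageNash_pureProfile_iff.2 he⟩⟩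
  obtain ⟨a, rfl⟩ := hMI h.mem_myopicIndifference
  have ha := isStageNash_pureProfile_iff.1 h
  rw [eq_of_mutually_stable hMI _ a e le_rfl (fun i => ha i _) fun i => he i _]

end StageGame

/-! ### The repeated game: round-by-round recursion for rewards and deterministic paths -/

section RepeatedGame

variable {I : Type*} [Fintype I] [DecidableEq I] {A Y : I → Type*}
  [∀ i, Fintype (A i)] [∀ i, DecidableEq (A i)] [∀ i, Fintype (Y i)] [∀ i, DecidableEq (Y i)]

lemma sum_prod_mixed {T : I → Type*} [∀ i, Fintype (T i)] (p : ∀ i, T i → ℝ)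
    (hp : ∀ i, ∑ η, p i η = 1) : ∑ θ : ∀ i, T i, ∏ i, p i (θ i) = 1 := by
  rw [← Fintype.piFinset_univ, ← Finset.prod_univ_sum]
  simp [hp]

lemma expReward_mono {r r' : (∀ i, A i) → ℝ} (h : ∀ a, r a ≤ r' a)
    (α : ∀ i, stdSimplex ℝ (A i)) : expReward r α ≤ expReward r' α :=
  Finset.sum_le_sum fun a _ =>
    mul_le_mul_of_nonneg_left (h a) (Finset.prod_nonneg fun j _ => (α j).2.1 _)

lemma expReward_const (c : ℝ) (α : ∀ i, stdSimplex ℝ (A i)) : expReward (fun _ => c) α = c := by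
  rw [expReward, ← Finset.sum_mul, sum_prod_mixed _ fun i => (α i).2.2, one_mul]

lemma sum_mul_le_of_stdSimplex {X : Type*} [Fintype X] (w : stdSimplex ℝ X) {f : X → ℝ} {c : ℝ}
    (h : ∀ x, f x ≤ c) : ∑ x, w.1 x * f x ≤ c :=
  calc _ ≤ ∑ x, w.1 x * c := Finset.sum_le_sum fun x _ =>
        mul_le_mul_of_nonneg_left (h x) (w.2.1 x)
    _ = c := by rw [← Finset.sum_mul, w.2.2, one_mul]

lemma sum_ofFn_succ {X : Type*} [Fintype X] (F : List X → ℝ) (m : ℕ) :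
    ∑ h : Fin (m + 1) → X, F (List.ofFn h) = ∑ x, ∑ h : Fin m → X, F (x :: List.ofFn h) := by
  rw [← (Fin.consEquiv fun _ => X).sum_comp, Fintype.sum_prod_type]
  simp [Fin.consEquiv, List.ofFn_succ]

lemma roundReward_zero (π : (∀ i, A i) → stdSimplex ℝ (∀ i, Y i)) (r : (∀ i, A i) → ℝ)
    (σ : StrategyProfile A Y) : roundReward π r σ 0 = expReward r fun i => σ i [] := by
  simp [roundReward, histProb, priv]

lemma roundReward_succ (π : (∀ i, A i) → stdSimplex ℝ (∀ i, Y i)) (r : (∀ i, A i) → ℝ)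
    (σ : StrategyProfile A Y) (m : ℕ) :
    roundReward π r σ (m + 1) =
      expReward (fun a => ∑ y, (π a).1 y * roundReward π r (continuation σ [(a, y)]) m)
        fun i => σ i [] := by
  have := sum_ofFn_succ
    (fun h => histProb π σ h * expReward r (fun i => σ i (priv i h))) m
  rw [roundReward, this, Fintype.sum_prod_type, expReward]
  refine Finset.sum_congr rfl fun a _ => ?_
  rw [Finset.mul_sum]
  refine Finset.sum_congr rfl fun y _ => ?_
  rw [roundReward, Finset.mul_sum, Finset.mul_sum]
  refine Finset.sum_congr rfl fun h _ => ?_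
  simp only [histProb, mul_assoc]
  rfl

lemma roundReward_le (π : (∀ i, A i) → stdSimplex ℝ (∀ i, Y i)) {r : (∀ i, A i) → ℝ} {c : ℝ}
    (hr : ∀ a, r a ≤ c) (m : ℕ) (σ : StrategyProfile A Y) : roundReward π r σ m ≤ c := by
  induction m generalizing σ with
  | zero => rw [roundReward_zero]; exact (expReward_mono hr _).trans_eq (expReward_const _ _)
  | succ m ih =>
    rw [roundReward_succ]
    exact (expReward_mono (fun a => sum_mul_le_of_stdSimplex _ fun y => ih _) _).trans_eq
      (expReward_const _ _)

lemma roundReward_neg (π : (∀ i, A i) → stdSimplex ℝ (∀ i, Y i)) (r : (∀ i, A i) → ℝ)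
    (σ : StrategyProfile A Y) (m : ℕ) :
    roundReward π (fun a => -r a) σ m = -roundReward π r σ m := by
  simp [roundReward, expReward_neg]

lemma abs_roundReward_le (π : (∀ i, A i) → stdSimplex ℝ (∀ i, Y i)) (r : (∀ i, A i) → ℝ)
    (σ : StrategyProfile A Y) (m : ℕ) : |roundReward π r σ m| ≤ ∑ a, |r a| := by
  have h : ∀ a, |r a| ≤ ∑ a, |r a| := fun a =>
    Finset.single_le_sum (f := fun a => |r a|) (fun a _ => abs_nonneg _) (Finset.mem_univ a)
  refine abs_le.2 ⟨?_, roundReward_le π (fun a => (le_abs_self _).trans (h a)) m σ⟩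
  rw [neg_le, ← roundReward_neg]
  exact roundReward_le π (fun a => (neg_le_abs _).trans (h a)) m σ

/-- The own actions in the private history `h` are those of the path `a`. -/
def Along {X Z : Type*} : (ℕ → X) → List (X × Z) → Prop
  | _, [] => True
  | a, x :: h => x.1 = a 0 ∧ Along (fun k => a (k + 1)) h

/-- As long as he has done so himself in the past, a player with strategy `s` follows the path `a`
in the first `n` rounds. -/
def Follows {X Z : Type*} [Fintype X] [DecidableEq X] (a : ℕ → X) (n : ℕ)
    (s : List (X × Z) → stdSimplex ℝ X) : Prop :=
  ∀ h, h.length < n → Along a h → s h = stdSimplex.vertex (a h.length)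

lemma follows_zero {X Z : Type*} [Fintype X] [DecidableEq X] (a : ℕ → X)
    (s : List (X × Z) → stdSimplex ℝ X) : Follows a 0 s :=
  fun _ h => absurd h (Nat.not_lt_zero _)

lemma follows_succ_iff {X Z : Type*} [Fintype X] [DecidableEq X] {a : ℕ → X} {n : ℕ}
    {s : List (X × Z) → stdSimplex ℝ X} :
    Follows a (n + 1) s ↔ s [] = stdSimplex.vertex (a 0) ∧
      ∀ y, Follows (fun k => a (k + 1)) n fun h => s ((a 0, y) :: h) := by
  constructor
  · exact fun h => ⟨h [] (Nat.succ_pos _) trivial, fun y l hl hal =>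
      h ((a 0, y) :: l) (by simpa using hl) ⟨rfl, hal⟩⟩
  · rintro ⟨h0, h1⟩ (_ | ⟨⟨c, y⟩, l⟩) hl hal
    · exact h0
    · obtain ⟨rfl, hal⟩ := hal
      exact h1 y l (by simpa using hl) hal

lemma roundReward_eq_of_follows (π : (∀ i, A i) → stdSimplex ℝ (∀ i, Y i)) (r : (∀ i, A i) → ℝ)
    (m : ℕ) (a : ℕ → ∀ i, A i) (σ : StrategyProfile A Y)
    (h : ∀ i, Follows (fun k => a k i) (m + 1) (σ i)) : roundReward π r σ m = r (a m) := by
  induction m generalizing a σ with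
  | zero =>
    rw [roundReward_zero, ← expReward_pureProfile r (a 0)]
    exact congrArg _ (funext fun i => (follows_succ_iff.1 (h i)).1)
  | succ m ih =>
    have h0 : (fun i => σ i []) = pureProfile (a 0) :=
      funext fun i => (follows_succ_iff.1 (h i)).1
    rw [roundReward_succ, h0, expReward_pureProfile, Finset.sum_congr rfl fun y _ => by
      rw [ih (fun k => a (k + 1)) (continuation σ [(a 0, y)]) fun i =>
        (follows_succ_iff.1 (h i)).2 (y i)]]
    rw [← Finset.sum_mul, (π (a 0)).2.2, one_mul]

/-- The strategy that plays `b` in the first round and then continues like `s`. -/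
noncomputable def startWith {X Z : Type*} [Fintype X] [DecidableEq X] (b : X)
    (s : List (X × Z) → stdSimplex ℝ X) : List (X × Z) → stdSimplex ℝ X
  | [] => stdSimplex.vertex b
  | x :: h => s (x :: h)

/-- Mixing in the first round amounts to drawing the first action and then playing on with the same
strategy, since `startWith` changes nothing after nonempty histories. -/
lemma roundReward_eq_sum_startWith (π : (∀ i, A i) → stdSimplex ℝ (∀ i, Y i))
    (r : (∀ i, A i) → ℝ) (σ : StrategyProfile A Y) (i : I) (m : ℕ) :
    roundReward π r σ m =
      ∑ b, (σ i []).1 b * roundReward π r (Function.update σ i (startWith b (σ i))) m := by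
  have hfirst : ∀ b, (fun j => Function.update σ i (startWith b (σ i)) j []) =
      Function.update (fun j => σ j []) i (stdSimplex.vertex b) := by
    intro b
    funext j
    by_cases hj : j = i
    · subst hj; simp [startWith]
    · simp [hj]
  have hcont : ∀ b x, continuation (Function.update σ i (startWith b (σ i))) [x] =
      continuation σ [x] := by
    intro b x
    funext j h
    by_cases hj : j = i
    · subst hj; simp [continuation, startWith, priv]
    · simp [continuation, hj]
  cases m with
  | zero =>
    simp_rw [roundReward_zero, hfirst]
    exact expReward_eq_sum r _ i
  | succ m =>
    simp_rw [roundReward_succ, hfirst, hcont]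
    exact expReward_eq_sum _ _ i

/-! ### Games with independent private types -/

section Types

variable {T : I → Type*} [∀ i, Fintype (T i)]

/-- The expected reward in the round that follows `m` rounds of play, when the players have
independent private types with distributions `p` and use type-dependent strategies `s`. -/
noncomputable def typeReward (π : (∀ i, A i) → stdSimplex ℝ (∀ i, Y i)) (r : (∀ i, A i) → ℝ)
    (p : ∀ i, T i → ℝ) (s : ∀ i, T i → List (A i × Y i) → stdSimplex ℝ (A i)) (m : ℕ) : ℝ :=
  ∑ θ : ∀ i, T i, (∏ j, p j (θ j)) * roundReward π r (fun j => s j (θ j)) m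

/-- For all discount factors between `d` and `1`, no player gains by a deviation in the repeated
game with independent private types of full support. -/
structure IsTypeNash (g : I → (∀ i, A i) → ℝ) (π : (∀ i, A i) → stdSimplex ℝ (∀ i, Y i)) (d : ℝ)
    (p : ∀ i, T i → ℝ) (s : ∀ i, T i → List (A i × Y i) → stdSimplex ℝ (A i)) : Prop where
  pos : ∀ i η, 0 < p i η
  sum_eq_one : ∀ i, ∑ η, p i η = 1
  -- The deviation ignores the type. A type-dependent deviation gives an average of such payoffs,
  -- since types are independent and do not enter rewards.
  le : ∀ i (τ : List (A i × Y i) → stdSimplex ℝ (A i)) (δ : ℝ), d ≤ δ → δ < 1 →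
    ∑' m : ℕ, δ ^ m * typeReward π (g i) p (Function.update s i fun _ => τ) m ≤
      ∑' m : ℕ, δ ^ m * typeReward π (g i) p s m

variable {g : I → (∀ i, A i) → ℝ} {π : (∀ i, A i) → stdSimplex ℝ (∀ i, Y i)} {d : ℝ}
  {p : ∀ i, T i → ℝ} {s : ∀ i, T i → List (A i × Y i) → stdSimplex ℝ (A i)}

lemma abs_typeReward_le (hpos : ∀ i η, 0 < p i η) (hsum : ∀ i, ∑ η, p i η = 1)
    (r : (∀ i, A i) → ℝ) (s : ∀ i, T i → List (A i × Y i) → stdSimplex ℝ (A i)) (m : ℕ) :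
    |typeReward π r p s m| ≤ ∑ a, |r a| := by
  refine (Finset.abs_sum_le_sum_abs _ _).trans ?_
  calc _ ≤ ∑ θ : ∀ i, T i, (∏ j, p j (θ j)) * ∑ a, |r a| := Finset.sum_le_sum fun θ _ => by
          have h : 0 ≤ ∏ j, p j (θ j) := Finset.prod_nonneg fun j _ => (hpos j _).le
          rw [abs_mul, abs_of_nonneg h]
          exact mul_le_mul_of_nonneg_left (abs_roundReward_le π r _ m) h
    _ = ∑ a, |r a| := by rw [← Finset.sum_mul, sum_prod_mixed p hsum, one_mul]

lemma summable_pow_mul {c : ℕ → ℝ} {C δ : ℝ} (hc : ∀ m, |c m| ≤ C) (h0 : 0 ≤ δ) (h1 : δ < 1) :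
    Summable fun m => δ ^ m * c m := by
  refine Summable.of_norm_bounded ((summable_geometric_of_lt_one h0 h1).mul_right C) fun m => ?_
  rw [norm_mul, Real.norm_of_nonneg (pow_nonneg h0 m)]
  exact mul_le_mul_of_nonneg_left (hc m) (pow_nonneg h0 m)

lemma summable_typeReward (hpos : ∀ i η, 0 < p i η) (hsum : ∀ i, ∑ η, p i η = 1)
    (r : (∀ i, A i) → ℝ) (s : ∀ i, T i → List (A i × Y i) → stdSimplex ℝ (A i)) {δ : ℝ}
    (h0 : 0 ≤ δ) (h1 : δ < 1) : Summable fun m => δ ^ m * typeReward π r p s m :=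
  summable_pow_mul (abs_typeReward_le hpos hsum r s) h0 h1

/-- A power series with bounded coefficients that vanishes on `[d, 1)` has zero constant term. -/
lemma coeff_zero_of_forall_tsum_eq_zero {c : ℕ → ℝ} {C d : ℝ} (hc : ∀ m, |c m| ≤ C) (h0 : 0 ≤ d)
    (h1 : d < 1) (h : ∀ δ, d ≤ δ → δ < 1 → ∑' m : ℕ, δ ^ m * c m = 0) : c 0 = 0 := by
  let P := FormalMultilinearSeries.ofScalars ℝ c
  have hrad : (1 : ENNReal) ≤ P.radius := by
    refine P.le_radius_of_bound (r := 1) C fun m => ?_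
    simpa [P, FormalMultilinearSeries.ofScalars_norm] using hc m
  have hsumP : ∀ x, P.sum x = ∑' m : ℕ, x ^ m * c m := by
    intro x
    simp [FormalMultilinearSeries.sum, P, mul_comm]
  have han : AnalyticOnNhd ℝ P.sum (Metric.ball 0 1) := by
    have hball := P.hasFPowerSeriesOnBall (zero_lt_one.trans_le hrad)
    refine hball.analyticOnNhd.mono fun x hx => ?_
    have : x ∈ Metric.eball (0 : ℝ) 1 := by
      rw [Metric.mem_eball, ← ENNReal.ofReal_one, edist_lt_ofReal]
      exact hx
    exact Metric.eball_subset_eball hrad this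
  -- Bounded coefficients make the sum analytic on the open unit ball; it vanishes near the midpoint
  -- of `[d, 1)`, hence also at `0` by the identity theorem.
  have hev : P.sum =ᶠ[𝓝 ((d + 1) / 2)] 0 := by
    filter_upwards [Ioo_mem_nhds (show d < (d + 1) / 2 by linarith)
      (show (d + 1) / 2 < 1 by linarith)] with δ hδ
    rw [hsumP]
    exact h δ hδ.1.le hδ.2
  have hmem : (d + 1) / 2 ∈ Metric.ball (0 : ℝ) 1 := by
    rw [mem_ball_zero_iff, Real.norm_of_nonneg (by linarith)]
    linarith
  have hz := han.eqOn_zero_of_preconnected_of_eventuallyEq_zero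
    (convex_ball 0 1).isPreconnected hmem hev (Metric.mem_ball_self zero_lt_one)
  rw [hsumP, tsum_eq_single 0 (fun m hm => by simp [hm])] at hz
  simpa using hz

/-- Redrawing one of several independent types does not change expectations. -/
lemma sum_resample (hsum : ∀ i, ∑ η, p i η = 1) (i : I) (G : (∀ i, T i) → ℝ) :
    ∑ θ : ∀ i, T i, (∏ j, p j (θ j)) * G θ =
      ∑ η, p i η * ∑ θ : ∀ i, T i, (∏ j, p j (θ j)) * G (Function.update θ i η) := by
  -- The involution exchanges the fresh draw with the type of `i`; the joint weight is symmetric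
  -- under it.
  have hinv : Function.Involutive fun x : T i × ∀ i, T i =>
      (x.2 i, Function.update x.2 i x.1) := by
    rintro ⟨η, θ⟩
    simp
  have h1 : ∑ θ : ∀ i, T i, (∏ j, p j (θ j)) * G θ =
      ∑ x : T i × ∀ i, T i, p i x.1 * ((∏ j, p j (x.2 j)) * G x.2) := by
    rw [Fintype.sum_prod_type, Finset.sum_comm]
    refine Finset.sum_congr rfl fun θ _ => ?_
    dsimp only
    rw [← Finset.sum_mul, hsum, one_mul]
  have h2 : ∑ η, p i η * ∑ θ : ∀ i, T i, (∏ j, p j (θ j)) * G (Function.update θ i η) =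
      ∑ x : T i × ∀ i, T i, p i x.1 * ((∏ j, p j (x.2 j)) * G (Function.update x.2 i x.1)) := by
    rw [Fintype.sum_prod_type]
    exact Finset.sum_congr rfl fun η _ => Finset.mul_sum _ _ _
  rw [h1, h2, ← Equiv.sum_comp hinv.toPerm]
  refine Finset.sum_congr rfl fun x _ => ?_
  change p i (x.2 i) * ((∏ j, p j (Function.update x.2 i x.1 j)) * G (Function.update x.2 i x.1)) = _
  rw [← mul_assoc, ← mul_assoc]
  congr 1
  rw [← Finset.mul_prod_erase _ _ (Finset.mem_univ i),
    ← Finset.mul_prod_erase _ (fun j => p j (x.2 j)) (Finset.mem_univ i), Function.update_self,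
    Finset.prod_congr rfl fun j hj => by rw [Function.update_of_ne (Finset.ne_of_mem_erase hj)]]
  ring

/-- The mixed action of a player in the first round, as seen by an observer who does not know his
type. -/
noncomputable def meanAction (hpos : ∀ i η, 0 < p i η) (hsum : ∀ i, ∑ η, p i η = 1)
    (s : ∀ i, T i → List (A i × Y i) → stdSimplex ℝ (A i)) (i : I) : stdSimplex ℝ (A i) :=
  ⟨fun a => ∑ η, p i η * (s i η []).1 a,
    fun a => Finset.sum_nonneg fun η _ => mul_nonneg (hpos i η).le ((s i η []).2.1 a), by
      rw [Finset.sum_comm, ← hsum i]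
      exact Finset.sum_congr rfl fun η _ => by rw [← Finset.mul_sum, (s i η []).2.2, mul_one]⟩

/-- Independence of the types turns the average of the product distributions into the product of the
averages. -/
lemma typeReward_zero (hpos : ∀ i η, 0 < p i η) (hsum : ∀ i, ∑ η, p i η = 1)
    (r : (∀ i, A i) → ℝ) : typeReward π r p s 0 = expReward r (meanAction hpos hsum s) := by
  simp_rw [typeReward, roundReward_zero, expReward, Finset.mul_sum]
  rw [Finset.sum_comm]
  refine Finset.sum_congr rfl fun a _ => ?_
  simp_rw [← mul_assoc, ← Finset.prod_mul_distrib]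
  rw [← Finset.sum_mul]
  congr 1
  simp only [meanAction]
  rw [Finset.prod_univ_sum, Fintype.piFinset_univ]

lemma meanAction_update (hpos : ∀ i η, 0 < p i η) (hsum : ∀ i, ∑ η, p i η = 1) (i : I)
    (τ : List (A i × Y i) → stdSimplex ℝ (A i)) :
    meanAction hpos hsum (Function.update s i fun _ => τ) =
      Function.update (meanAction hpos hsum s) i (τ []) := by
  funext j
  by_cases hj : j = i
  · subst hj
    refine Subtype.ext (funext fun a => ?_)
    simp only [meanAction, Function.update_self]
    rw [← Finset.sum_mul, hsum, one_mul]
  · refine Subtype.ext (funext fun a => ?_)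
    simp only [meanAction, Function.update_of_ne hj]

lemma typeReward_eq_sum_startWith (hsum : ∀ i, ∑ η, p i η = 1) (r : (∀ i, A i) → ℝ) (i : I)
    (m : ℕ) :
    typeReward π r p s m = ∑ x : T i × A i, p i x.1 * (s i x.1 []).1 x.2 *
      typeReward π r p (Function.update s i fun _ => startWith x.2 (s i x.1)) m := by
  rw [typeReward, sum_resample hsum i, Fintype.sum_prod_type]
  refine Finset.sum_congr rfl fun η _ => ?_
  simp_rw [mul_assoc]
  rw [← Finset.mul_sum]
  congr 1
  simp_rw [typeReward, Finset.mul_sum]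
  rw [Finset.sum_comm]
  refine Finset.sum_congr rfl fun θ _ => ?_
  rw [roundReward_eq_sum_startWith π r _ i, Finset.mul_sum]
  refine Finset.sum_congr rfl fun b _ => ?_
  have : Function.update (fun j => s j (Function.update θ i η j)) i
      (startWith b (s i (Function.update θ i η i))) =
      fun j => Function.update s i (fun _ => startWith b (s i η)) j (θ j) := by
    funext j
    by_cases hj : j = i
    · subst hj; simp
    · simp [hj]
  rw [this, Function.update_self]
  ring

/-- An action used by some type is optimal in the first round for every discount factor. -/
lemma IsTypeNash.tsum_startWith_eq (h : IsTypeNash g π d p s) (hd : 0 ≤ d) {i : I} {η : T i}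
    {b : A i} (hb : 0 < (s i η []).1 b) {δ : ℝ} (hδ : d ≤ δ) (hδ1 : δ < 1) :
    ∑' m : ℕ, δ ^ m *
        typeReward π (g i) p (Function.update s i fun _ => startWith b (s i η)) m =
      ∑' m : ℕ, δ ^ m * typeReward π (g i) p s m := by
  let w : T i × A i → ℝ := fun x => p i x.1 * (s i x.1 []).1 x.2
  let W : T i × A i → ℝ := fun x => ∑' m : ℕ, δ ^ m *
    typeReward π (g i) p (Function.update s i fun _ => startWith x.2 (s i x.1)) m
  set V := ∑' m : ℕ, δ ^ m * typeReward π (g i) p s m with hV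
  have hδ0 := hd.trans hδ
  have hw : ∀ x, 0 ≤ w x := fun x => mul_nonneg (h.pos i _).le ((s i x.1 []).2.1 _)
  have hw1 : ∑ x, w x = 1 := by
    rw [Fintype.sum_prod_type, ← h.sum_eq_one i]
    exact Finset.sum_congr rfl fun η _ => by
      simp only [w]; rw [← Finset.mul_sum, (s i η []).2.2, mul_one]
  -- The equilibrium value is an average, over types and their first actions, of deviation values
  -- that do not exceed it; those with positive weight must be equal to it.
  have hVW : V = ∑ x, w x * W x := by
    simp only [W, ← tsum_mul_left]
    rw [← Summable.tsum_finsetSum fun x _ =>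
      (summable_typeReward h.pos h.sum_eq_one (g i) _ hδ0 hδ1).mul_left _, hV]
    refine tsum_congr fun m => ?_
    rw [typeReward_eq_sum_startWith h.sum_eq_one, Finset.mul_sum]
    exact Finset.sum_congr rfl fun x _ => by simp only [w]; ring
  have hle : ∀ x, W x ≤ V := fun x => h.le i _ δ hδ hδ1
  have hzero : ∑ x, w x * (V - W x) = 0 := by
    simp_rw [mul_sub]
    rw [Finset.sum_sub_distrib, ← Finset.sum_mul, hw1, one_mul, ← hVW, sub_self]
  have := (Finset.sum_eq_zero_iff_of_nonneg fun x _ =>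
    mul_nonneg (hw x) (sub_nonneg.2 (hle x))).1 hzero (η, b) (Finset.mem_univ _)
  have hwpos : 0 < w (η, b) := mul_pos (h.pos i η) hb
  exact (sub_eq_zero.1 ((mul_eq_zero.1 this).resolve_left hwpos.ne')).symm

lemma IsTypeNash.meanAction_mem (h : IsTypeNash g π d p s) (hd : 0 ≤ d) (hd1 : d < 1) :
    meanAction h.pos h.sum_eq_one s ∈ myopicIndifference g := by
  intro i b hb
  obtain ⟨η, hη⟩ : ∃ η, 0 < (s i η []).1 b := by
    by_contra! hcon
    refine hb.not_ge (Finset.sum_nonpos fun η _ => ?_)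
    exact mul_nonpos_of_nonneg_of_nonpos (h.pos i η).le (hcon η)
  have hbound : ∀ m, |typeReward π (g i) p (Function.update s i fun _ => startWith b (s i η)) m -
      typeReward π (g i) p s m| ≤ ∑ a, |g i a| + ∑ a, |g i a| := fun m =>
    (abs_sub _ _).trans (add_le_add (abs_typeReward_le h.pos h.sum_eq_one _ _ m)
      (abs_typeReward_le h.pos h.sum_eq_one _ _ m))
  -- The constant term of the payoff difference is the difference of the rewards in the first round
  -- alone.
  have := coeff_zero_of_forall_tsum_eq_zero hbound hd hd1 fun δ hδ hδ1 => by
    simp_rw [mul_sub]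
    rw [Summable.tsum_sub (summable_typeReward h.pos h.sum_eq_one _ _ (hd.trans hδ) hδ1)
      (summable_typeReward h.pos h.sum_eq_one _ _ (hd.trans hδ) hδ1),
      h.tsum_startWith_eq hd hη hδ hδ1, sub_self]
  rw [sub_eq_zero, typeReward_zero h.pos h.sum_eq_one, typeReward_zero h.pos h.sum_eq_one,
    meanAction_update] at this
  exact this

lemma IsTypeNash.exists_first_action (h : IsTypeNash g π d p s) (hd : 0 ≤ d) (hd1 : d < 1)
    (hMI : myopicIndifference g ⊆ Set.range pureProfile) :
    ∃ a : ∀ i, A i, ∀ i η, s i η [] = stdSimplex.vertex (a i) := by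
  obtain ⟨a, ha⟩ := hMI (h.meanAction_mem hd hd1)
  refine ⟨a, fun i η => eq_vertex_of_forall_ne fun b hb => ?_⟩
  have h0 : ∑ η, p i η * (s i η []).1 b = 0 := by
    have := congrArg (fun γ => (γ i).1 b) ha
    simp only [pureProfile, vertex_val_apply, if_neg hb] at this
    exact this.symm
  have := (Finset.sum_eq_zero_iff_of_nonneg fun η _ =>
    mul_nonneg (h.pos i η).le ((s i η []).2.1 b)).1 h0 η (Finset.mem_univ _)
  exact (mul_eq_zero.1 this).resolve_left (h.pos i η).ne'

lemma sum_marginal (i : I) (a : ∀ i, A i) : ∑ y, marginal π i a y = 1 := by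
  simp_rw [marginal]
  rw [Finset.sum_comm, ← (π a).2.2]
  exact Finset.sum_congr rfl fun y _ => by simp

/-- Since the first action profile is pure, conditional independence splits the weight of the signal
profile into one factor per player, which is absorbed into that player's type. -/
lemma typeReward_succ (hind : ConditionallyIndependent π) {a : ∀ i, A i} (r : (∀ i, A i) → ℝ)
    (hs : ∀ i η, s i η [] = stdSimplex.vertex (a i)) (m : ℕ) :
    typeReward π r p s (m + 1) =
      typeReward π r (fun i (x : T i × Y i) => p i x.1 * marginal π i a x.2)
        (fun i x h => s i x.1 ((a i, x.2) :: h)) m := by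
  let e : (∀ i, T i × Y i) ≃ (∀ i, T i) × ∀ i, Y i :=
    { toFun := fun f => (fun i => (f i).1, fun i => (f i).2)
      invFun := fun x i => (x.1 i, x.2 i)
      left_inv := fun _ => rfl
      right_inv := fun _ => rfl }
  rw [typeReward, typeReward, ← e.symm.sum_comp, Fintype.sum_prod_type]
  refine Finset.sum_congr rfl fun θ _ => ?_
  have h0 : (fun i => s i (θ i) []) = pureProfile a := funext fun i => hs i (θ i)
  rw [roundReward_succ, h0, expReward_pureProfile, Finset.mul_sum]
  refine Finset.sum_congr rfl fun y _ => ?_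
  rw [hind a y, ← mul_assoc, ← Finset.prod_mul_distrib]
  rfl

/-- When all types of all players choose the same action in the first round, the signals of that
round become part of the types, and play goes on as a game with independent types. -/
lemma IsTypeNash.continuation (h : IsTypeNash g π d p s) (hd : 0 < d)
    (hind : ConditionallyIndependent π) (hfull : FullSupport π) {a : ∀ i, A i}
    (hs : ∀ i η, s i η [] = stdSimplex.vertex (a i)) :
    IsTypeNash g π d (fun i (x : T i × Y i) => p i x.1 * marginal π i a x.2)
      (fun i x h => s i x.1 ((a i, x.2) :: h)) := by
  have hpos : ∀ i (x : T i × Y i), 0 < p i x.1 * marginal π i a x.2 := fun i x =>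
    mul_pos (h.pos i _) (hfull i _ a)
  have hsum : ∀ i, ∑ x : T i × Y i, p i x.1 * marginal π i a x.2 = 1 := by
    intro i
    rw [Fintype.sum_prod_type, ← h.sum_eq_one i]
    exact Finset.sum_congr rfl fun η _ => by
      dsimp only
      rw [← Finset.mul_sum, sum_marginal, mul_one]
  refine ⟨hpos, hsum, fun i τ δ hδ hδ1 => ?_⟩
  have hδ0 : 0 < δ := hd.trans_le hδ
  -- Conform in the first round, then play `τ`. The first rewards cancel, and a factor `δ` remains,
  -- which can be divided out because `0 < d ≤ δ`.
  let τ' : List (A i × Y i) → stdSimplex ℝ (A i) := fun h =>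
    match h with
    | [] => stdSimplex.vertex (a i)
    | _ :: l => τ l
  have hle := h.le i τ' δ hδ hδ1
  have hs' : ∀ j η, Function.update s i (fun _ => τ') j η [] = stdSimplex.vertex (a j) := by
    intro j η
    by_cases hj : j = i
    · subst hj; simp [τ']
    · simp [hj, hs]
  have hcont : (fun j (x : T j × Y j) h =>
      Function.update s i (fun _ => τ') j x.1 ((a j, x.2) :: h)) =
      Function.update (fun j (x : T j × Y j) h => s j x.1 ((a j, x.2) :: h)) i fun _ => τ := by
    funext j x l
    by_cases hj : j = i
    · subst hj; simp [τ']
    · simp [hj]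
  have hzero : typeReward π (g i) p (Function.update s i fun _ => τ') 0 =
      typeReward π (g i) p s 0 := by
    rw [typeReward_zero h.pos h.sum_eq_one, typeReward_zero h.pos h.sum_eq_one]
    congr 1
    funext j
    refine Subtype.ext (funext fun b => ?_)
    simp only [meanAction, hs, hs']
  rw [(summable_typeReward h.pos h.sum_eq_one (g i) _ hδ0.le hδ1).tsum_eq_zero_add,
    (summable_typeReward h.pos h.sum_eq_one (g i) _ hδ0.le hδ1).tsum_eq_zero_add, hzero] at hle
  simp_rw [typeReward_succ hind (g i) hs, typeReward_succ hind (g i) hs', hcont, pow_succ',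
    mul_assoc, tsum_mul_left] at hle
  exact le_of_mul_le_mul_left (le_of_add_le_add_left hle) hδ0

end Types

end RepeatedGame

/-! ### Equilibrium play is a fixed path, and the path is the stage Nash equilibrium -/

section Deterministic

universe u v w

variable {I : Type u} [Fintype I] [DecidableEq I] {A : I → Type v} {Y : I → Type w}
  [∀ i, Fintype (A i)] [∀ i, DecidableEq (A i)] [∀ i, Fintype (Y i)] [∀ i, DecidableEq (Y i)]
  {g : I → (∀ i, A i) → ℝ} {π : (∀ i, A i) → stdSimplex ℝ (∀ i, Y i)} {d : ℝ}

/-- In an equilibrium with independent types, play follows a deterministic path. -/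
lemma IsTypeNash.exists_follows (hd : 0 < d) (hd1 : d < 1)
    (hMI : myopicIndifference g ⊆ Set.range pureProfile) (hind : ConditionallyIndependent π)
    (hfull : FullSupport π) (n : ℕ) {T : I → Type w} [∀ i, Fintype (T i)] {p : ∀ i, T i → ℝ}
    {s : ∀ i, T i → List (A i × Y i) → stdSimplex ℝ (A i)} (h : IsTypeNash g π d p s) :
    ∃ a : ℕ → ∀ i, A i, ∀ i η, Follows (fun k => a k i) n (s i η) := by
  -- `T` and `Y` live in the same universe, so the enlarged types `T i × Y i` are again admissible.
  induction n generalizing T with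
  | zero =>
    -- Only needed to have some action profile, as the action sets are not assumed nonempty here.
    obtain ⟨a, -⟩ := h.exists_first_action hd.le hd1 hMI
    exact ⟨fun _ => a, fun i η => follows_zero _ _⟩
  | succ n ih =>
    obtain ⟨a, ha⟩ := h.exists_first_action hd.le hd1 hMI
    obtain ⟨a', ha'⟩ := ih (h.continuation hd hind hfull ha)
    exact ⟨fun k => Nat.casesOn k a a', fun i η =>
      follows_succ_iff.2 ⟨ha i η, fun y => ha' i (η, y)⟩⟩

/-- The strategy that plays `b` in the first round and then continues as `s` does when `c` was
played in the first round. -/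
noncomputable def deviateOnce {X Z : Type*} [Fintype X] [DecidableEq X] (b c : X)
    (s : List (X × Z) → stdSimplex ℝ X) : List (X × Z) → stdSimplex ℝ X
  | [] => stdSimplex.vertex b
  | x :: h => s ((c, x.2) :: h)

lemma follows_deviateOnce {X Z : Type*} [Fintype X] [DecidableEq X] {b : X} {a : ℕ → X} {n : ℕ}
    {s : List (X × Z) → stdSimplex ℝ X} (h : Follows a (n + 1) s) :
    Follows (Function.update a 0 b) (n + 1) (deviateOnce b (a 0) s) :=
  follows_succ_iff.2 ⟨by simp [deviateOnce], fun y => (follows_succ_iff.1 h).2 y⟩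

/-- A deviation in the first round does not affect later play, so the first action profile is a
Nash equilibrium of the stage game. -/
lemma IsTypeNash.isStageNash (hd : 0 < d) (hd1 : d < 1)
    (hMI : myopicIndifference g ⊆ Set.range pureProfile) (hind : ConditionallyIndependent π)
    (hfull : FullSupport π) {T : I → Type w} [∀ i, Fintype (T i)] {p : ∀ i, T i → ℝ}
    {s : ∀ i, T i → List (A i × Y i) → stdSimplex ℝ (A i)} (h : IsTypeNash g π d p s)
    {a : ∀ i, A i} (ha : ∀ i η, s i η [] = stdSimplex.vertex (a i)) :
    IsStageNash g (pureProfile a) := by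
  refine isStageNash_pureProfile_iff.2 fun i b => ?_
  have hne : ∀ j, Nonempty (T j) := by
    intro j
    by_contra hcon
    rw [not_nonempty_iff] at hcon
    simpa using h.sum_eq_one j
  obtain ⟨η⟩ := hne i
  let s' := Function.update s i fun _ => deviateOnce b (a i) (s i η)
  -- The path `c` may depend on the horizon `m`. The opponents stay on it whatever signals the
  -- deviation causes, and the deviator returns to it by pretending to have played `a i`; only the
  -- first round changes.
  have hrew : ∀ m, ∃ c : ℕ → ∀ i, A i, c 0 = a ∧ typeReward π (g i) p s m = g i (c m) ∧
      typeReward π (g i) p s' m = g i (Function.update c 0 (Function.update a i b) m) := by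
    intro m
    obtain ⟨c, hc⟩ := h.exists_follows hd hd1 hMI hind hfull (m + 1)
    have hc0 : c 0 = a := by
      funext j
      obtain ⟨ζ⟩ := hne j
      have := (follows_succ_iff.1 (hc j ζ)).1
      rw [ha] at this
      exact (stdSimplex.vertex_injective this).symm
    have hval : ∀ (t : ∀ i, T i → List (A i × Y i) → stdSimplex ℝ (A i)) (c : ℕ → ∀ i, A i),
        (∀ j ζ, Follows (fun k => c k j) (m + 1) (t j ζ)) →
        typeReward π (g i) p t m = g i (c m) := by
      intro t c hc
      rw [typeReward, Finset.sum_congr rfl fun θ _ => by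
        rw [roundReward_eq_of_follows π (g i) m c _ fun j => hc j (θ j)]]
      rw [← Finset.sum_mul, sum_prod_mixed p h.sum_eq_one, one_mul]
    refine ⟨c, hc0, hval s c hc, hval s' _ fun j ζ => ?_⟩
    by_cases hj : j = i
    · subst hj
      have := follows_deviateOnce (b := b) (hc j η)
      simp only [s', Function.update_self]
      convert this using 1
      · funext k
        rcases k with _ | k <;> simp
      · rw [hc0]
    · simp only [s', Function.update_of_ne hj]
      convert hc j ζ using 1
      funext k
      rcases k with _ | k <;> simp [hj, hc0]
  have hle := h.le i (deviateOnce b (a i) (s i η)) d le_rfl hd1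
  rw [(summable_typeReward h.pos h.sum_eq_one (g i) _ hd.le hd1).tsum_eq_zero_add,
    (summable_typeReward h.pos h.sum_eq_one (g i) _ hd.le hd1).tsum_eq_zero_add] at hle
  have htail : ∀ m, typeReward π (g i) p s' (m + 1) = typeReward π (g i) p s (m + 1) := by
    intro m
    obtain ⟨c, -, h1, h2⟩ := hrew (m + 1)
    rw [h1, h2, Function.update_of_ne (Nat.succ_ne_zero m)]
  change _ + ∑' m : ℕ, d ^ (m + 1) * typeReward π (g i) p s' (m + 1) ≤ _ at hle
  simp_rw [htail] at hle
  have h0 := le_of_add_le_add_right hle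
  obtain ⟨c, hc0, h1, h2⟩ := hrew 0
  rw [pow_zero, one_mul, one_mul, h1, hc0] at h0
  change typeReward π (g i) p s' 0 ≤ _ at h0
  rwa [h2, Function.update_self] at h0

/-- Every continuation is itself an equilibrium with types, so its first profile is again the unique
stage equilibrium. -/
lemma IsTypeNash.follows_const (hd : 0 < d) (hd1 : d < 1)
    (hMI : myopicIndifference g ⊆ Set.range pureProfile) (hind : ConditionallyIndependent π)
    (hfull : FullSupport π) {e : ∀ i, A i} (he : ∀ α, IsStageNash g α → α = pureProfile e)
    (n : ℕ) {T : I → Type w} [∀ i, Fintype (T i)] {p : ∀ i, T i → ℝ}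
    {s : ∀ i, T i → List (A i × Y i) → stdSimplex ℝ (A i)} (h : IsTypeNash g π d p s) (i : I)
    (η : T i) : Follows (fun _ => e i) n (s i η) := by
  induction n generalizing T with
  | zero => exact follows_zero _ _
  | succ n ih =>
    obtain ⟨a, ha⟩ := h.exists_first_action hd.le hd1 hMI
    obtain rfl := pureProfile_injective (he _ (h.isStageNash hd hd1 hMI hind hfull ha))
    exact follows_succ_iff.2 ⟨ha i η, fun y => ih (h.continuation hd hind hfull ha) (η, y)⟩

lemma outcomeProb_eq_one_of_follows (e : ∀ i, A i) (t : ℕ) (σ : StrategyProfile A Y)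
    (h : ∀ i, Follows (fun _ => e i) t (σ i)) : outcomeProb π σ t (fun _ => e) = 1 := by
  induction t generalizing σ with
  | zero => simp [outcomeProb, histProb]
  | succ t ih =>
    have hsum := sum_ofFn_succ (fun l => histProb π σ (l.map fun y => (e, y))) t
    simp only [List.map_ofFn, List.map_cons] at hsum
    have h0 : ∏ i, (σ i []).1 (e i) = 1 := Finset.prod_eq_one fun i _ => by
      rw [(follows_succ_iff.1 (h i)).1, vertex_val_apply, if_pos rfl]
    change ∑ y : Fin (t + 1) → ∀ i, Y i, _ = _
    refine hsum.trans ?_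
    rw [← (π e).2.2]
    refine Finset.sum_congr rfl fun y _ => ?_
    simp only [histProb, h0, one_mul]
    rw [← Finset.mul_sum]
    have := ih (continuation σ [(e, y)]) fun i => (follows_succ_iff.1 (h i)).2 (y i)
    exact (congrArg _ this).trans (mul_one _)

end Deterministic

/-! ### From Blackwell equilibria to games with types, and existence -/

section Equilibrium

variable {I : Type*} [Fintype I] [DecidableEq I] {A Y : I → Type*}
  [∀ i, Fintype (A i)] [∀ i, DecidableEq (A i)] [∀ i, Fintype (Y i)] [∀ i, DecidableEq (Y i)]
  {g : I → (∀ i, A i) → ℝ} {π : (∀ i, A i) → stdSimplex ℝ (∀ i, Y i)}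

lemma interimPayoff_nil (r : (∀ i, A i) → ℝ) (μ : Beliefs A Y) (σ : StrategyProfile A Y) (d : ℝ)
    (i : I) : interimPayoff π r μ σ d i [] = payoff π r σ d := by
  have h : ∀ h : Fin ([] : List (A i × Y i)).length → Round A Y,
      continuation σ (List.ofFn h) = σ := fun h => by
    rw [show List.ofFn h = [] from List.ofFn_zero]
    rfl
  simp_rw [interimPayoff, h]
  rw [← Finset.sum_mul, (μ i []).2.2, one_mul]

lemma possible_nil (σ : StrategyProfile A Y) (i : I) : Possible π i [] := by
  refine ⟨σ, ?_⟩
  have : privProb π σ i [] = ∑ h : Fin 0 → Round A Y,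
      if priv i (List.ofFn h) = [] then histProb π σ (List.ofFn h) else 0 := rfl
  rw [this]
  simp [priv, histProb]

/-- A Blackwell equilibrium, seen as an equilibrium of the game with trivial types. -/
lemma IsBlackwellEquilibrium.exists_isTypeNash {σ : StrategyProfile A Y}
    (h : IsBlackwellEquilibrium g π σ) : ∃ d : ℝ, 0 < d ∧ d < 1 ∧
      IsTypeNash g π d (T := fun _ => PUnit) (fun _ _ => 1) (fun i _ => σ i) := by
  obtain ⟨d, -, hd1, h⟩ := h
  have hval : ∀ (r : (∀ i, A i) → ℝ) (t : StrategyProfile A Y) m,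
      typeReward π r (T := fun _ => PUnit) (fun _ _ => 1) (fun i _ => t i) m =
        roundReward π r t m := by
    intro r t m
    simp [typeReward]
  -- The bound is raised to be positive, as `IsTypeNash.continuation` requires.
  refine ⟨max d (1 / 2), by positivity, max_lt hd1 (by norm_num), fun _ _ => one_pos,
    fun i => by simp, fun i τ δ hδ hδ1 => ?_⟩
  obtain ⟨μ, -, hrat⟩ := h (fun _ => δ) fun _ => ⟨(le_max_left _ _).trans hδ, hδ1⟩
  have := hrat i [] (possible_nil σ i) τ
  rw [interimPayoff_nil, interimPayoff_nil, payoff, payoff] at this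
  have hup : (Function.update (fun i (_ : PUnit) => σ i) i fun _ => τ) =
      fun j _ => Function.update σ i τ j := by
    funext j
    by_cases hj : j = i
    · subst hj; simp
    · simp [hj]
  rw [hup, tsum_congr fun m => congrArg (δ ^ m * ·) (hval (g i) (Function.update σ i τ) m),
    tsum_congr fun m => congrArg (δ ^ m * ·) (hval (g i) σ m)]
  exact le_of_mul_le_mul_left this (sub_pos.2 hδ1)

/-! ### Existence -/

lemma histProb_nonneg (σ : StrategyProfile A Y) (h : List (Round A Y)) : 0 ≤ histProb π σ h := by
  induction h generalizing σ with
  | nil => exact zero_le_one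
  | cons x h ih =>
    exact mul_nonneg (mul_nonneg (Finset.prod_nonneg fun i _ => (σ i []).2.1 _) ((π _).2.1 _))
      (ih _)

lemma histProb_pos (hπ : ∀ a y, 0 < (π a).1 y) {σ : StrategyProfile A Y}
    (hσ : ∀ i hi a, 0 < (σ i hi).1 a) (h : List (Round A Y)) : 0 < histProb π σ h := by
  induction h generalizing σ with
  | nil => exact zero_lt_one
  | cons x h ih =>
    exact mul_pos (mul_pos (Finset.prod_pos fun i _ => hσ i _ _) (hπ _ _))
      (ih fun i hi a => hσ i _ a)

lemma exists_priv_eq [∀ i, Nonempty (A i)] [∀ i, Nonempty (Y i)] (i : I) (hi : List (A i × Y i)) :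
    ∃ h : Fin hi.length → Round A Y, priv i (List.ofFn h) = hi := by
  classical
  refine ⟨fun k => (Function.update (fun j => Classical.arbitrary (A j)) i (hi.get k).1,
    Function.update (fun j => Classical.arbitrary (Y j)) i (hi.get k).2), ?_⟩
  rw [priv, List.map_ofFn]
  conv_rhs => rw [← List.ofFn_get hi]
  congr 1
  funext k
  simp

lemma privProb_pos [∀ i, Nonempty (A i)] [∀ i, Nonempty (Y i)] (hπ : ∀ a y, 0 < (π a).1 y)
    {σ : StrategyProfile A Y} (hσ : ∀ i hi a, 0 < (σ i hi).1 a) (i : I)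
    (hi : List (A i × Y i)) : 0 < privProb π σ i hi := by
  obtain ⟨h, hh⟩ := exists_priv_eq (A := A) (Y := Y) i hi
  refine Finset.sum_pos' (fun h _ => ?_) ⟨h, Finset.mem_univ h, ?_⟩
  · split_ifs
    exacts [histProb_nonneg _ _, le_rfl]
  · rw [if_pos hh]
    exact histProb_pos hπ hσ _

lemma posterior_mem_stdSimplex {σ : StrategyProfile A Y} {i : I} {hi : List (A i × Y i)}
    (hpos : 0 < privProb π σ i hi) :
    posterior π σ i hi ∈ stdSimplex ℝ (Fin hi.length → Round A Y) := by
  constructor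
  · intro h
    unfold posterior
    split_ifs
    exacts [div_nonneg (histProb_nonneg _ _) hpos.le, le_rfl]
  · have : ∀ h, posterior π σ i hi h =
        (if priv i (List.ofFn h) = hi then histProb π σ (List.ofFn h) else 0) /
          privProb π σ i hi := by
      intro h
      unfold posterior
      split_ifs <;> simp
    simp_rw [this]
    rw [← Finset.sum_div]
    exact div_self hpos.ne'

/-- Under full support, every profile is part of a consistent assessment. -/
lemma exists_consistent [∀ i, Nonempty (A i)] [∀ i, Nonempty (Y i)] (hπ : ∀ a y, 0 < (π a).1 y)
    (σ : StrategyProfile A Y) : ∃ μ, Consistent π σ μ := by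
  -- Vanishing weight of the uniform tremble.
  let c : ℕ → ℝ := fun k => 1 / ((k : ℝ) + 1)
  have hc0 : ∀ k, 0 < c k := fun k => Nat.one_div_pos_of_nat
  have hc1 : ∀ k, c k ≤ 1 := fun k => by
    simp only [c]
    rw [div_le_one (by positivity)]
    linarith [(Nat.cast_nonneg k : (0 : ℝ) ≤ k)]
  let τ : ℕ → StrategyProfile A Y := fun k i hi =>
    ⟨fun a => (1 - c k) * (σ i hi).1 a + c k * (Fintype.card (A i) : ℝ)⁻¹, fun a =>
      add_nonneg (mul_nonneg (sub_nonneg.2 (hc1 k)) ((σ i hi).2.1 a))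
        (mul_nonneg (hc0 k).le (by positivity)), by
      rw [Finset.sum_add_distrib, ← Finset.mul_sum, (σ i hi).2.2, Finset.sum_const,
        Finset.card_univ, nsmul_eq_mul]
      have : (Fintype.card (A i) : ℝ) ≠ 0 := Nat.cast_ne_zero.2 Fintype.card_ne_zero
      field_simp
      ring⟩
  have hτ : ∀ k i hi a, 0 < (τ k i hi).1 a := fun k i hi a =>
    add_pos_of_nonneg_of_pos (mul_nonneg (sub_nonneg.2 (hc1 k)) ((σ i hi).2.1 a))
      (mul_pos (hc0 k) (inv_pos.2 (Nat.cast_pos.2 Fintype.card_pos)))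
  have hlim : ∀ i hi a, Tendsto (fun k => (τ k i hi).1 a) atTop (𝓝 ((σ i hi).1 a)) := by
    intro i hi a
    have h0 : Tendsto c atTop (𝓝 0) := tendsto_one_div_add_atTop_nhds_zero_nat
    have := ((tendsto_const_nhds (x := (1 : ℝ))).sub h0).mul_const ((σ i hi).1 a) |>.add
      (h0.mul_const (Fintype.card (A i) : ℝ)⁻¹)
    simpa [τ] using this
  let β : ℕ → Beliefs A Y := fun k i hi =>
    ⟨posterior π (τ k) i hi, posterior_mem_stdSimplex (privProb_pos hπ (hτ k) i hi)⟩
  -- Compactness of the product over all private histories yields one subsequence along which all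
  -- posteriors converge.
  obtain ⟨μ, -, φ, hφ, hμ⟩ := isCompact_univ.tendsto_subseq fun k => Set.mem_univ (β k)
  refine ⟨μ, fun k => τ (φ k), fun k => hτ _, fun i hi a =>
    (hlim i hi a).comp hφ.tendsto_atTop, fun i hi _ h => ?_⟩
  have hcont : Continuous fun b : Beliefs A Y => (b i hi).1 h :=
    (continuous_apply h).comp (continuous_subtype_val.comp
      ((continuous_apply hi).comp (continuous_apply i)))
  exact (hcont.tendsto μ).comp hμ

/-- The repetition of the pure action profile `e`, whatever happened in the past. -/
noncomputable def repeatProfile (Y : I → Type*) (e : ∀ i, A i) : StrategyProfile A Y :=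
  fun i _ => stdSimplex.vertex (e i)

/-- The opponents never react, so after any first round the deviator faces the same situation and
can at best earn the stage equilibrium reward. -/
lemma roundReward_update_repeatProfile_le {i : I} {e : ∀ i, A i}
    (he : IsStageNash g (pureProfile e)) (m : ℕ) (τ : List (A i × Y i) → stdSimplex ℝ (A i)) :
    roundReward π (g i) (Function.update (repeatProfile Y e) i τ) m ≤ g i e := by
  induction m generalizing τ with
  | zero =>
    rw [roundReward_zero, ← expReward_pureProfile (g i) e]
    convert he i (τ []) using 2
    funext j
    by_cases hj : j = i
    · subst hj; simp
    · simp [hj, repeatProfile, pureProfile]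
  | succ m ih =>
    rw [roundReward_succ]
    refine (expReward_mono (fun a => sum_mul_le_of_stdSimplex _ fun y => ?_) _).trans_eq
      (expReward_const (g i e) _)
    convert ih (fun h => τ ((a i, y i) :: h)) using 2
    funext j h
    by_cases hj : j = i
    · subst hj; simp [continuation, priv]
    · simp [continuation, hj, repeatProfile]

lemma payoff_update_repeatProfile_le {i : I} {e : ∀ i, A i}
    (he : IsStageNash g (pureProfile e)) {d : ℝ} (hd : 0 ≤ d) (hd1 : d < 1)
    (τ : List (A i × Y i) → stdSimplex ℝ (A i)) :
    payoff π (g i) (Function.update (repeatProfile Y e) i τ) d ≤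
      payoff π (g i) (repeatProfile Y e) d := by
  refine mul_le_mul_of_nonneg_left (Summable.tsum_le_tsum (fun m => ?_)
    (summable_pow_mul (abs_roundReward_le π (g i) _) hd hd1)
    (summable_pow_mul (abs_roundReward_le π (g i) _) hd hd1)) (sub_nonneg.2 hd1.le)
  rw [roundReward_eq_of_follows π (g i) m (fun _ => e) (repeatProfile Y e)
    fun i h _ _ => rfl]
  exact mul_le_mul_of_nonneg_left (roundReward_update_repeatProfile_le he m τ) (pow_nonneg hd m)

/-- The repetition of a Nash equilibrium in pure actions is a Blackwell equilibrium. -/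
lemma isBlackwellEquilibrium_repeatProfile [∀ i, Nonempty (A i)] [∀ i, Nonempty (Y i)]
    (hπ : ∀ a y, 0 < (π a).1 y) {e : ∀ i, A i} (he : IsStageNash g (pureProfile e)) :
    IsBlackwellEquilibrium g π (repeatProfile Y e) := by
  obtain ⟨μ, hμ⟩ := exists_consistent hπ (repeatProfile Y e)
  refine ⟨0, le_rfl, one_pos, fun δ hδ => ⟨μ, hμ, fun i hi _ τ => ?_⟩⟩
  -- Optimality holds at each history separately, so the beliefs do not matter and serve all
  -- discount factors.
  refine Finset.sum_le_sum fun h _ => mul_le_mul_of_nonneg_left ?_ ((μ i hi).2.1 h)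
  have hcont : continuation (Function.update (repeatProfile Y e) i τ) (List.ofFn h) =
      Function.update (repeatProfile Y e) i fun h' => τ (priv i (List.ofFn h) ++ h') := by
    funext j h'
    by_cases hj : j = i
    · subst hj; simp [continuation]
    · simp [continuation, hj, repeatProfile]
  rw [hcont]
  exact payoff_update_repeatProfile_le he (hδ i).1 (hδ i).2 _

end Equilibrium

end AntiFolk

theorem theorem4 {I : Type*} [Fintype I] [DecidableEq I] {A Y : I → Type*}
    [∀ i, Fintype (A i)] [∀ i, DecidableEq (A i)] [∀ i, Nonempty (A i)]
    [∀ i, Fintype (Y i)] [∀ i, DecidableEq (Y i)]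
    (g : I → (∀ i, A i) → ℝ) (π : (∀ i, A i) → stdSimplex ℝ (∀ i, Y i))
    (hMI : AntiFolk.myopicIndifference g = Set.range AntiFolk.pureProfile)
    (hind : AntiFolk.ConditionallyIndependent π) (hfull : AntiFolk.FullSupport π) :
    ∃ e : ∀ i, A i,
      (∀ α : ∀ i, stdSimplex ℝ (A i),
        AntiFolk.IsStageNash g α ↔ α = AntiFolk.pureProfile e) ∧
      (∃ σ : AntiFolk.StrategyProfile A Y, AntiFolk.IsBlackwellEquilibrium g π σ) ∧
      ∀ σ : AntiFolk.StrategyProfile A Y, AntiFolk.IsBlackwellEquilibrium g π σ →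
        AntiFolk.HasOutcome π σ (fun _ => e) := by
  obtain ⟨e, he⟩ := AntiFolk.exists_unique_stageNash hMI.subset
  refine ⟨e, he, ⟨AntiFolk.repeatProfile Y e, ?_⟩, fun σ hσ t => ?_⟩
  -- A probability vector on the signal profiles exists, so there is at least one of them.
  · have hY : Nonempty (∀ i, Y i) := by
      by_contra hcon
      rw [not_nonempty_iff] at hcon
      simpa using (π e).2.2
    have : ∀ i, Nonempty (Y i) := fun i => hY.map fun y => y i
    refine AntiFolk.isBlackwellEquilibrium_repeatProfile (fun a y => ?_) ((he _).2 rfl)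
    rw [hind a y]
    exact Finset.prod_pos fun i _ => hfull i _ a
  · obtain ⟨d, hd, hd1, h⟩ := hσ.exists_isTypeNash
    exact AntiFolk.outcomeProb_eq_one_of_follows e t σ fun i =>
      h.follows_const hd hd1 hMI.subset hind hfull (fun α => (he α).1) t i PUnit.unit
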